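/- Let $d\ge 2$ and let $\Omega\subset\mathbb R^d$ be a bounded open set (in particular, any bounded domain with smooth boundary). Let $H^1(\Omega)$ be the Sobolev space of complex functions, let $H^1_0(\Omega)$ be the closure of $C_c^\infty(\Omega)$ in it, let $H^{1/2}(\partial\Omega):=H^1(\Omega)/H^1_0(\Omega)$ be the space of boundary values (identified with the usual trace space on $\partial\Omega$ when $\partial\Omega$ is smooth), and let $H^{-1/2}(\partial\Omega)$ be its dual; the pairing $\langle\cdot,\cdot\rangle$ of $H^{1/2}$ and $H^{-1/2}$ is bilinear. A conductivity is a real $\gamma\in L^\infty(\Omega)$ with $\gamma\ge c$ a.e. for some constant $c>0$. Its Dirichlet-to-Neumann map $\Phi(\gamma)=\Lambda_\gamma\in\mathcal L(H^{1/2}(\partial\Omega),H^{-1/2}(\partial\Omega))$ is defined by $$\langle f,\Lambda_\gamma g\rangle=\int_\Omega \gamma\,\nabla u_f\cdot\nabla u_g^\gamma\,dx ,$$ where $u_f\in H^1(\Omega)$ is any function with boundary value $f$, and $u^\gamma_g\in H^1(\Omega)$ is the weak solution of $-\nabla\cdot(\gamma\nabla u)=0$ in $\Omega$ with boundary value $g$.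 Let $d\Phi_1$ be the Fréchet differential of $\Phi$ at the conductivity $\sigma=1$, extended complex-linearly to complex $L^\infty(\Omega)$, and further extended linearly to $L^\infty(\Omega)+\mathcal E'(\Omega)$, where $\mathcal E'(\Omega)$ is the space of compactly supported distributions on $\Omega$, by $$\langle f,d\Phi_1(T)g\rangle=\langle T,\chi\,\nabla u_f^1\cdot\nabla u_g^1\rangle\qquad (T\in\mathcal E'(\Omega)),$$ with $\chi\in C_c^\infty(\Omega)$ such that $\chi T=T$. For $w=g+T$ with $g\in L^\infty(\Omega)$ and $T\in\mathcal E'(\Omega)$, let $\mathcal F w(\xi)=\int_\Omega e^{-ix\cdot\xi}g(x)\,dx+\langle T,e^{-ix\cdot\xi}\rangle$ be its Fourier transform. For $\eta\in\mathbb C^d$ write $e_\eta(x)=e^{\eta\cdot x}$, where $\eta\cdot x=\sum_i\eta_ix_i$. Let $\gamma\in L^\infty(\Omega)$ be a conductivity, and suppose that $\gamma^{\mathrm B}_1\in L^\infty(\Omega)+\mathcal E'(\Omega)$ satisfies $d\Phi_1(\gamma^{\mathrm B}_1)=\Lambda_\gamma$. Then for every $\xi\in\mathbb R^d\setminus\{0\}$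 and all $\eta_1,\eta_2\in\mathbb C^d$ with $\eta_1\cdot\eta_1=\eta_2\cdot\eta_2=0$ (bilinear products) and $\eta_1+\eta_2=-i\xi$, $$\mathcal F\gamma^{\mathrm B}_1(\xi)=-\frac{2}{|\xi|^2}\,\langle e_{\eta_1},\Lambda_\gamma e_{\eta_2}\rangle .$$ Consequently $\gamma^{\mathrm B}_1$ is uniquely determined by $\Lambda_\gamma$ in $L^\infty(\Omega)+\mathcal E'(\Omega)$: if $\gamma'\in L^\infty(\Omega)$ is a conductivity with $\Lambda_{\gamma'}=\Lambda_\gamma$, and $w'\in L^\infty(\Omega)+\mathcal E'(\Omega)$ satisfies $d\Phi_1(w')=\Lambda_{\gamma'}$, then $w'=\gamma^{\mathrm B}_1$. -/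

import Mathlib

open MeasureTheory TopologicalSpace Distributions
open scoped ENNReal ContDiff Matrix

noncomputable section

namespace Calderon

/-- Euclidean space `ℝᵈ`. -/
abbrev Rd (d : ℕ) : Type := EuclideanSpace ℝ (Fin d)

/-- Lebesgue measure on the open set `Ω`. -/
abbrev vol {d : ℕ} (Ω : Opens (Rd d)) : Measure (Rd d) := volume.restrict (Ω : Set (Rd d))

/-- The classical partial derivative `∂ᵢ u (x)`. -/
def partialDeriv {d : ℕ} (i : Fin d) (u : Rd d → ℂ) (x : Rd d) : ℂ :=
  fderiv ℝ u x (EuclideanSpace.single i (1 : ℝ))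

/-! ### The Sobolev space `H¹(Ω)` and the space of boundary values -/

/-- `L²(Ω) × L²(Ω)ᵈ` with its Hilbert norm. -/
abbrev L2Jet {d : ℕ} (Ω : Opens (Rd d)) : Type :=
  WithLp 2 (Lp ℂ 2 (vol Ω) × PiLp 2 (fun _ : Fin d => Lp ℂ 2 (vol Ω)))

theorem integrable_mul_test {d : ℕ} {Ω : Opens (Rd d)} (f : Lp ℂ 2 (vol Ω)) (ψ : Rd d → ℝ)
    (hψ : Continuous ψ) (hc : HasCompactSupport ψ) :
    Integrable (fun x => f x * (ψ x : ℂ)) (vol Ω) := by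
  have h2 : MemLp (fun x => (ψ x : ℂ)) 2 (vol Ω) :=
    (Continuous.memLp_of_hasCompactSupport (μ := vol Ω) (p := 2) hψ hc).ofReal
  exact MemLp.integrable_mul (Lp.memLp f) h2

theorem test_deriv_continuous {d : ℕ} {Ω : Opens (Rd d)} (φ : 𝓓(Ω, ℝ)) (v : Rd d) :
    Continuous (fun x => fderiv ℝ φ x v) :=
  (φ.contDiff.continuous_fderiv (by simp)).clm_apply continuous_const

theorem test_deriv_compact {d : ℕ} {Ω : Opens (Rd d)} (φ : 𝓓(Ω, ℝ)) (v : Rd d) :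
    HasCompactSupport (fun x => fderiv ℝ φ x v) :=
  φ.hasCompactSupport.fderiv_apply ℝ v

/-- `H¹(Ω)`: the pairs `(u, G)` in `L²(Ω) × L²(Ω)ᵈ` such that `G` is the weak gradient of `u`,
with the norm `(‖u‖² + ∑ᵢ ‖∂ᵢ u‖²)^(1/2)`. -/
def H1 {d : ℕ} (Ω : Opens (Rd d)) : Submodule ℂ (L2Jet Ω) where
  carrier := {U | ∀ (φ : 𝓓(Ω, ℝ)) (i : Fin d),
    ∫ x in (Ω : Set (Rd d)), U.fst x * (fderiv ℝ φ x (EuclideanSpace.single i (1 : ℝ)) : ℂ)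
      = - ∫ x in (Ω : Set (Rd d)), U.snd i x * (φ x : ℂ)}
  zero_mem' := by
    intro φ i
    have h1 : ∀ ψ : Rd d → ℂ,
        ∫ x in (Ω : Set (Rd d)), (0 : Lp ℂ 2 (vol Ω)) x * ψ x = 0 := by
      intro ψ
      rw [integral_eq_zero_of_ae]
      filter_upwards [Lp.coeFn_zero ℂ 2 (vol Ω)] with x hx
      rw [hx, Pi.zero_apply, zero_mul]
    have := h1 (fun x => (fderiv ℝ φ x (EuclideanSpace.single i (1 : ℝ)) : ℂ))
    have h' := h1 (fun x => (φ x : ℂ))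
    simp only [WithLp.zero_fst, WithLp.zero_snd, PiLp.zero_apply]
    rw [this, h', neg_zero]
  add_mem' := by
    intro U V hU hV φ i
    have key : ∀ (f g : Lp ℂ 2 (vol Ω)) (ψ : Rd d → ℝ), Continuous ψ → HasCompactSupport ψ →
        ∫ x in (Ω : Set (Rd d)), (f + g : Lp ℂ 2 (vol Ω)) x * (ψ x : ℂ)
          = (∫ x in (Ω : Set (Rd d)), f x * (ψ x : ℂ))
            + ∫ x in (Ω : Set (Rd d)), g x * (ψ x : ℂ) := by
      intro f g ψ h1 h2
      rw [← integral_add (integrable_mul_test f ψ h1 h2) (integrable_mul_test g ψ h1 h2)]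
      refine integral_congr_ae ?_
      filter_upwards [Lp.coeFn_add f g] with x hx
      rw [hx, Pi.add_apply, add_mul]
    simp only [WithLp.add_fst, WithLp.add_snd, PiLp.add_apply]
    rw [key _ _ _ (test_deriv_continuous φ _) (test_deriv_compact φ _),
      key _ _ _ φ.continuous φ.hasCompactSupport, hU φ i, hV φ i, neg_add]
  smul_mem' := by
    intro c U hU φ i
    have key : ∀ (f : Lp ℂ 2 (vol Ω)) (ψ : Rd d → ℂ),
        ∫ x in (Ω : Set (Rd d)), (c • f : Lp ℂ 2 (vol Ω)) x * ψ x
          = c * ∫ x in (Ω : Set (Rd d)), f x * ψ x := by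
      intro f ψ
      rw [← integral_const_mul]
      refine integral_congr_ae ?_
      filter_upwards [Lp.coeFn_smul c f] with x hx
      rw [hx, Pi.smul_apply, smul_eq_mul, mul_assoc]
    simp only [WithLp.smul_fst, WithLp.smul_snd, PiLp.smul_apply]
    rw [key _ (fun x => (fderiv ℝ φ x (EuclideanSpace.single i (1 : ℝ)) : ℂ)),
      key _ (fun x => (φ x : ℂ)), hU φ i, mul_neg]

/-- The function underlying an element of `H¹(Ω)`. -/
def sobVal {d : ℕ} {Ω : Opens (Rd d)} (u : H1 Ω) : Lp ℂ 2 (vol Ω) := (u : L2Jet Ω).fst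

/-- The weak partial derivative `∂ᵢ u` of `u ∈ H¹(Ω)`. -/
def sobGrad {d : ℕ} {Ω : Opens (Rd d)} (u : H1 Ω) (i : Fin d) : Lp ℂ 2 (vol Ω) :=
  (u : L2Jet Ω).snd i

/-- The test functions `C_c^∞(Ω)`, as a subspace of `H¹(Ω)`. -/
def testSubmodule {d : ℕ} (Ω : Opens (Rd d)) : Submodule ℂ (H1 Ω) where
  carrier := {u | ∃ φ : 𝓓(Ω, ℂ), ∀ᵐ x ∂(vol Ω), (sobVal u) x = φ x}
  zero_mem' := by
    refine ⟨0, ?_⟩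
    filter_upwards [Lp.coeFn_zero ℂ 2 (vol Ω)] with x hx
    exact hx
  add_mem' := by
    rintro u v ⟨φ, hφ⟩ ⟨ψ, hψ⟩
    refine ⟨φ + ψ, ?_⟩
    filter_upwards [hφ, hψ, Lp.coeFn_add (sobVal u) (sobVal v)] with x h1 h2 h3
    change ((sobVal u) + (sobVal v) : Lp ℂ 2 (vol Ω)) x = φ x + ψ x
    rw [h3, Pi.add_apply, h1, h2]
  smul_mem' := by
    rintro c u ⟨φ, hφ⟩
    refine ⟨c • φ, ?_⟩
    filter_upwards [hφ, Lp.coeFn_smul c (sobVal u)] with x h1 h2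
    change (c • (sobVal u) : Lp ℂ 2 (vol Ω)) x = c • φ x
    rw [h2, Pi.smul_apply, h1]

/-- `H¹₀(Ω)`: the closure of `C_c^∞(Ω)` in `H¹(Ω)`. -/
def H10 {d : ℕ} (Ω : Opens (Rd d)) : Submodule ℂ (H1 Ω) := (testSubmodule Ω).topologicalClosure

theorem isClosed_H10 {d : ℕ} (Ω : Opens (Rd d)) : IsClosed (H10 Ω : Set (H1 Ω)) :=
  Submodule.isClosed_topologicalClosure _

/-- `H^{1/2}(∂Ω)`, the space of boundary values of `H¹(Ω)` functions: the quotient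
`H¹(Ω) / H¹₀(Ω)` with the quotient norm. When `∂Ω` is smooth, the trace operator identifies it with
the space of traces on `∂Ω`, since the kernel of the trace is `H¹₀(Ω)`. -/
def Hhalf {d : ℕ} (Ω : Opens (Rd d)) : Type := H1 Ω ⧸ H10 Ω

instance {d : ℕ} (Ω : Opens (Rd d)) : NormedAddCommGroup (Hhalf Ω) :=
  Submodule.Quotient.normedAddCommGroup (H10 Ω) (hS := isClosed_H10 Ω)

instance {d : ℕ} (Ω : Opens (Rd d)) : NormedSpace ℂ (Hhalf Ω) :=
  Submodule.Quotient.normedSpace (H10 Ω) ℂ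

/-- The boundary value `u|_{∂Ω}` of `u ∈ H¹(Ω)`. -/
def bdry {d : ℕ} {Ω : Opens (Rd d)} : H1 Ω →ₗ[ℂ] Hhalf Ω := (H10 Ω).mkQ

/-- `H^{-1/2}(∂Ω)`: the dual of `H^{1/2}(∂Ω)` with the dual norm. -/
def HminusHalf {d : ℕ} (Ω : Opens (Rd d)) : Type := Hhalf Ω →L[ℂ] ℂ

instance {d : ℕ} (Ω : Opens (Rd d)) : NormedAddCommGroup (HminusHalf Ω) :=
  inferInstanceAs (NormedAddCommGroup (Hhalf Ω →L[ℂ] ℂ))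

instance {d : ℕ} (Ω : Opens (Rd d)) : NormedSpace ℂ (HminusHalf Ω) :=
  inferInstanceAs (NormedSpace ℂ (Hhalf Ω →L[ℂ] ℂ))

/-- The bilinear duality pairing `⟨f, h⟩_{H^{1/2} × H^{-1/2}}`. -/
def bdryPair {d : ℕ} {Ω : Opens (Rd d)} (f : Hhalf Ω) (h : HminusHalf Ω) : ℂ :=
  (show Hhalf Ω →L[ℂ] ℂ from h) f

/-- The bounded operators `ℒ(H^{1/2}(∂Ω), H^{-1/2}(∂Ω))`. -/
abbrev BdryOp {d : ℕ} (Ω : Opens (Rd d)) : Type := Hhalf Ω →L[ℂ] HminusHalf Ω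

/-! ### Conductivities, the Dirichlet-to-Neumann map and its differential -/

/-- A conductivity: a real function in `L^∞(Ω)` bounded below a.e. by a positive constant. -/
def IsConductivity {d : ℕ} {Ω : Opens (Rd d)} (γ : Lp ℝ ∞ (vol Ω)) : Prop :=
  ∃ c : ℝ, 0 < c ∧ ∀ᵐ x ∂(vol Ω), c ≤ γ x

/-- The (bilinear) form `∫_Ω γ ∇u · ∇v dx`. -/
def energy {d : ℕ} {Ω : Opens (Rd d)} (γ : Lp ℝ ∞ (vol Ω)) (u v : H1 Ω) : ℂ :=
  ∫ x in (Ω : Set (Rd d)), (γ x : ℂ) * ∑ i, sobGrad u i x * sobGrad v i x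

/-- `u ∈ H¹(Ω)` is a weak solution of `-∇·(γ∇u) = 0` in `Ω`. -/
def IsWeakSolution {d : ℕ} {Ω : Opens (Rd d)} (γ : Lp ℝ ∞ (vol Ω)) (u : H1 Ω) : Prop :=
  ∀ φ ∈ H10 Ω, energy γ φ u = 0

/-- `Λ` is the Dirichlet-to-Neumann map of `γ`: `⟨f, Λ g⟩ = ∫_Ω γ ∇u_f · ∇u_g^γ dx`, whenever
`u_f ∈ H¹(Ω)` has boundary value `f`, and `u_g^γ` is a weak solution with boundary value `g`. -/
def IsDtN {d : ℕ} {Ω : Opens (Rd d)} (γ : Lp ℝ ∞ (vol Ω)) (Λ : BdryOp Ω) : Prop :=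
  ∀ u v : H1 Ω, IsWeakSolution γ v → bdryPair (bdry u) (Λ (bdry v)) = energy γ u v

open scoped Classical in
/-- The map `Φ : γ ↦ Λ_γ`, with the value `0` at those `γ` that have no Dirichlet-to-Neumann map
(none of them is a conductivity). -/
def dtn {d : ℕ} {Ω : Opens (Rd d)} (γ : Lp ℝ ∞ (vol Ω)) : BdryOp Ω :=
  if h : ∃ Λ : BdryOp Ω, IsDtN γ Λ then h.choose else 0

/-- The Fréchet differential `dΦ_σ`, extended complex-linearly from real to complex `L^∞(Ω)`. -/
def dtnDiff {d : ℕ} {Ω : Opens (Rd d)} (σ : Lp ℝ ∞ (vol Ω)) (g : Lp ℂ ∞ (vol Ω)) : BdryOp Ω :=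
  fderiv ℝ (dtn (Ω := Ω)) σ (Complex.reCLM.compLp g)
    + Complex.I • fderiv ℝ (dtn (Ω := Ω)) σ (Complex.imCLM.compLp g)

/-- The constant conductivity `1`. -/
def oneCond {d : ℕ} (Ω : Opens (Rd d)) : Lp ℝ ∞ (vol Ω) :=
  (memLp_top_const (1 : ℝ)).toLp (fun _ => (1 : ℝ))

/-! ### Compactly supported distributions -/

/-- The compactly supported distributions `ℰ'(Ω)`: those that vanish off a compact subset
of `Ω`. -/
def IsCompactlySupported {d : ℕ} {Ω : Opens (Rd d)} (T : 𝓓'(Ω, ℂ)) : Prop :=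
  ∃ K : Set (Rd d), IsCompact K ∧ K ⊆ Ω ∧ Distribution.IsVanishingOn (⇑T) Kᶜ

/-- The product of a test function on `Ω` and a function that is smooth on `Ω`. -/
def mulSmooth {d : ℕ} {Ω : Opens (Rd d)} (χ : 𝓓(Ω, ℝ)) (F : Rd d → ℝ)
    (hF : ContDiffOn ℝ ∞ F Ω) : 𝓓(Ω, ℝ) where
  toFun x := χ x * F x
  contDiff' := by
    refine contDiff_iff_contDiffAt.2 fun x => ?_
    by_cases hx : x ∈ tsupport χ
    · exact χ.contDiff.contDiffAt.mul (hF.contDiffAt (Ω.isOpen.mem_nhds (χ.tsupport_subset hx)))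
    · refine (contDiffAt_const (c := (0 : ℝ))).congr_of_eventuallyEq ?_
      filter_upwards [(isClosed_tsupport χ).isOpen_compl.mem_nhds hx] with y hy
      simp [image_eq_zero_of_notMem_tsupport hy]
  hasCompactSupport' := χ.hasCompactSupport.mul_right
  tsupport_subset' := (tsupport_mul_subset_left).trans χ.tsupport_subset

/-- `χ T = T`. -/
def IsCutoff {d : ℕ} {Ω : Opens (Rd d)} (χ : 𝓓(Ω, ℝ)) (T : 𝓓'(Ω, ℂ)) : Prop :=
  ∀ φ : 𝓓(Ω, ℝ), T (mulSmooth χ φ φ.contDiff.contDiffOn) = T φ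

open scoped Classical in
/-- The duality pairing `⟨T, F⟩_{ℰ' × C^∞} = T (χ F)`, where `χ ∈ C_c^∞(Ω)` is any function with
`χ T = T` (the value does not depend on it), of `T ∈ ℰ'(Ω)` and a complex function `F` that is
smooth on `Ω`. (Distributions in Mathlib are tested against real functions.) -/
def pairing {d : ℕ} {Ω : Opens (Rd d)} (T : 𝓓'(Ω, ℂ)) (F : Rd d → ℂ) : ℂ :=
  if h : (∃ χ : 𝓓(Ω, ℝ), IsCutoff χ T) ∧ ContDiffOn ℝ ∞ F Ω then
    T (mulSmooth h.1.choose (fun x => (F x).re)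
        (Complex.reCLM.contDiff.comp_contDiffOn h.2))
      + Complex.I * T (mulSmooth h.1.choose (fun x => (F x).im)
        (Complex.imCLM.contDiff.comp_contDiffOn h.2))
  else 0

/-! ### Extension of the differential to `L^∞(Ω) + ℰ'(Ω)` -/

open scoped Classical in
/-- The smooth representative on `Ω` of the solution `u_f^σ` of `-∇·(σ∇u) = 0` with boundary value
`f`. It exists, by interior elliptic regularity, and is unique on `Ω` when `σ` is a conductivity in
`C^∞`, such as `σ = 1`. -/
def smoothSolution {d : ℕ} {Ω : Opens (Rd d)} (σ : Lp ℝ ∞ (vol Ω)) (f : Hhalf Ω) : Rd d → ℂ :=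
  if h : ∃ U : Rd d → ℂ, ContDiffOn ℝ ∞ U Ω ∧
      ∃ u : H1 Ω, IsWeakSolution σ u ∧ bdry u = f ∧ ∀ᵐ x ∂(vol Ω), (sobVal u) x = U x
  then h.choose else 0

/-- `⟨f, dΦ_σ(T) g⟩ = ⟨T, χ ∇u_f^σ · ∇u_g^σ⟩` for `T ∈ ℰ'(Ω)` and smooth `σ`. -/
def dtnDiffDistr {d : ℕ} {Ω : Opens (Rd d)} (σ : Lp ℝ ∞ (vol Ω)) (T : 𝓓'(Ω, ℂ))
    (f g : Hhalf Ω) : ℂ :=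
  pairing T (fun x =>
    ∑ i, partialDeriv i (smoothSolution σ f) x * partialDeriv i (smoothSolution σ g) x)

/-- `w = g + T` as distributions on `Ω`, with `g ∈ L^∞(Ω)` and `T ∈ ℰ'(Ω)`. -/
def IsSplitting {d : ℕ} {Ω : Opens (Rd d)} (w : 𝓓'(Ω, ℂ)) (g : Lp ℂ ∞ (vol Ω))
    (T : 𝓓'(Ω, ℂ)) : Prop :=
  IsCompactlySupported T ∧
    ∀ φ : 𝓓(Ω, ℝ), w φ = (∫ x in (Ω : Set (Rd d)), (φ x : ℂ) * g x) + T φ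

/-- `w ∈ L^∞(Ω) + ℰ'(Ω)` and `dΦ_σ(w) = B`, where `dΦ_σ` is extended from `L^∞(Ω)` to
`L^∞(Ω) + ℰ'(Ω)` (for smooth `σ`) by `dΦ_σ(g + T) = dΦ_σ(g) + dΦ_σ(T)`. -/
def HasDtnDiff {d : ℕ} {Ω : Opens (Rd d)} (σ : Lp ℝ ∞ (vol Ω)) (w : 𝓓'(Ω, ℂ))
    (B : BdryOp Ω) : Prop :=
  ∃ (g : Lp ℂ ∞ (vol Ω)) (T : 𝓓'(Ω, ℂ)), IsSplitting w g T ∧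
    ∀ f₁ f₂ : Hhalf Ω,
      bdryPair f₁ (dtnDiff σ g f₂) + dtnDiffDistr σ T f₁ f₂ = bdryPair f₁ (B f₂)

/-- `w` is a Born approximation of `γ` with respect to the background conductivity `1`:
`w ∈ L^∞(Ω) + ℰ'(Ω)` and `dΦ_1(w) = Λ_γ`. -/
def IsBornApprox {d : ℕ} {Ω : Opens (Rd d)} (γ : Lp ℝ ∞ (vol Ω)) (w : 𝓓'(Ω, ℂ)) : Prop :=
  HasDtnDiff (oneCond Ω) w (dtn γ)

/-- `z = (ℱ w)(ξ)`, for `w ∈ L^∞(Ω) + ℰ'(Ω)`: whenever `w = g + T`, one has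
`z = ∫_Ω e^{-ix·ξ} g(x) dx + ⟨T, e^{-ix·ξ}⟩`. -/
def HasFourierValue {d : ℕ} {Ω : Opens (Rd d)} (w : 𝓓'(Ω, ℂ)) (ξ : Rd d) (z : ℂ) : Prop :=
  (∃ (g : Lp ℂ ∞ (vol Ω)) (T : 𝓓'(Ω, ℂ)), IsSplitting w g T) ∧
  ∀ (g : Lp ℂ ∞ (vol Ω)) (T : 𝓓'(Ω, ℂ)), IsSplitting w g T →
    (∫ x in (Ω : Set (Rd d)), Complex.exp (-Complex.I * (inner ℝ x ξ : ℝ)) * g x)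
      + pairing T (fun x => Complex.exp (-Complex.I * (inner ℝ x ξ : ℝ))) = z

/-! ### Exponentials -/

/-- `e_η(x) = exp(η · x)`, for `η ∈ ℂᵈ`. -/
def expFun {d : ℕ} (η : Fin d → ℂ) (x : Rd d) : ℂ := Complex.exp (∑ i, η i * (x i : ℂ))

theorem expFun_contDiff {d : ℕ} (η : Fin d → ℂ) : ContDiff ℝ ∞ (expFun η) := by
  unfold expFun
  refine Complex.contDiff_exp.comp (ContDiff.sum fun i _ => contDiff_const.mul ?_)
  exact Complex.ofRealCLM.contDiff.comp (EuclideanSpace.proj (𝕜 := ℝ) i).contDiff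

theorem memLp_of_continuous {d : ℕ} {Ω : Opens (Rd d)}
    (hΩ : Bornology.IsBounded (Ω : Set (Rd d))) {u : Rd d → ℂ} (hu : Continuous u) :
    MemLp u 2 (vol Ω) := by
  have : IsFiniteMeasure (vol Ω) := ⟨by
    rw [Measure.restrict_apply_univ]
    exact hΩ.measure_lt_top⟩
  obtain ⟨C, hC⟩ := hΩ.isCompact_closure.exists_bound_of_continuousOn hu.continuousOn
  refine MemLp.of_bound hu.aestronglyMeasurable C ?_
  filter_upwards [ae_restrict_mem Ω.isOpen.measurableSet] with x hx
  exact hC x (subset_closure hx)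

theorem partialDeriv_continuous {d : ℕ} {u : Rd d → ℂ} (hu : ContDiff ℝ ∞ u) (i : Fin d) :
    Continuous (partialDeriv i u) :=
  (hu.continuous_fderiv (by simp)).clm_apply continuous_const

theorem integral_partialDeriv_test {d : ℕ} {Ω : Opens (Rd d)} {u : Rd d → ℂ}
    (hu : ContDiff ℝ ∞ u) (φ : 𝓓(Ω, ℝ)) (i : Fin d) :
    ∫ x in (Ω : Set (Rd d)), u x * (fderiv ℝ φ x (EuclideanSpace.single i (1 : ℝ)) : ℂ)
      = - ∫ x in (Ω : Set (Rd d)), partialDeriv i u x * (φ x : ℂ) := by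
  have hφ0 : ∀ x, x ∉ (Ω : Set (Rd d)) → φ x = 0 := fun x hx =>
    image_eq_zero_of_notMem_tsupport fun h => hx (φ.tsupport_subset h)
  have hφ1 : ∀ x, x ∉ (Ω : Set (Rd d)) →
      fderiv ℝ φ x (EuclideanSpace.single i (1 : ℝ)) = 0 := fun x hx =>
    image_eq_zero_of_notMem_tsupport (f := fun x => fderiv ℝ φ x (EuclideanSpace.single i (1 : ℝ)))
      fun h => hx (φ.tsupport_subset (tsupport_fderiv_apply_subset ℝ _ h))
  rw [setIntegral_eq_integral_of_forall_compl_eq_zero (fun x hx => by simp [hφ1 x hx]),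
    setIntegral_eq_integral_of_forall_compl_eq_zero (fun x hx => by simp [hφ0 x hx])]
  have c1 := test_deriv_continuous φ (EuclideanSpace.single i (1 : ℝ))
  have c2 := test_deriv_compact φ (EuclideanSpace.single i (1 : ℝ))
  have hp := partialDeriv_continuous hu i
  have h := integral_smul_fderiv_eq_neg_fderiv_smul_of_integrable (μ := (volume : Measure (Rd d)))
    (𝕜 := ℝ) (f := φ) (g := u) (v := EuclideanSpace.single i (1 : ℝ))
    ((c1.smul hu.continuous).integrable_of_hasCompactSupport c2.smul_right)
    ((φ.continuous.smul hp).integrable_of_hasCompactSupport φ.hasCompactSupport.smul_right)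
    ((φ.continuous.smul hu.continuous).integrable_of_hasCompactSupport
      φ.hasCompactSupport.smul_right)
    (fun x _ => φ.contDiff.differentiable (by simp) x)
    (fun x _ => hu.differentiable (by simp) x)
  have e1 : ∀ x, u x * (fderiv ℝ φ x (EuclideanSpace.single i (1 : ℝ)) : ℂ)
      = fderiv ℝ φ x (EuclideanSpace.single i (1 : ℝ)) • u x := fun x => by
    rw [Complex.real_smul, mul_comm]
  have e2 : ∀ x, partialDeriv i u x * (φ x : ℂ)
      = φ x • fderiv ℝ u x (EuclideanSpace.single i (1 : ℝ)) := fun x => by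
    rw [Complex.real_smul, mul_comm, partialDeriv]
  simp_rw [e1, e2]
  rw [h, neg_neg]

/-- The restriction to a bounded open set `Ω` of a smooth function on `ℝᵈ`, as an element of
`H¹(Ω)`. -/
def ofSmooth {d : ℕ} {Ω : Opens (Rd d)} (hΩ : Bornology.IsBounded (Ω : Set (Rd d)))
    (u : Rd d → ℂ) (hu : ContDiff ℝ ∞ u) : H1 Ω :=
  ⟨WithLp.toLp 2 ((memLp_of_continuous hΩ hu.continuous).toLp u,
    WithLp.toLp 2 fun i =>
      (memLp_of_continuous hΩ (partialDeriv_continuous hu i)).toLp (partialDeriv i u)), by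
    intro φ i
    have h1 := (memLp_of_continuous hΩ hu.continuous).coeFn_toLp
    have h2 := (memLp_of_continuous hΩ (partialDeriv_continuous hu i)).coeFn_toLp
    refine Eq.trans (integral_congr_ae ?_) ((integral_partialDeriv_test hu φ i).trans
      (congrArg Neg.neg (integral_congr_ae ?_)))
    · filter_upwards [h1] with x hx
      exact congrArg (· * _) hx
    · filter_upwards [h2] with x hx
      exact congrArg (· * _) hx.symm⟩

/-- The boundary value `e_η|_{∂Ω} ∈ H^{1/2}(∂Ω)`. -/
def bdryExp {d : ℕ} {Ω : Opens (Rd d)} (hΩ : Bornology.IsBounded (Ω : Set (Rd d)))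
    (η : Fin d → ℂ) : Hhalf Ω :=
  bdry (ofSmooth hΩ (expFun η) (expFun_contDiff η))

end Calderon

end

open Calderon

/-!
The two assertions follow from a formula for `dΦ₁` and from the density of exponentials.

*The differential of `Φ` at `1`.* Let `P` be the orthogonal projection of `L²(Ω)ᵈ` onto the
gradients of `H¹₀(Ω)` functions, which form a closed subspace by the Poincaré inequality
(`exists_poincare`). A function `v` with boundary value `g` solves `∇·((1 + h)∇v) = 0` if and only
if `(1 + P h)∇v = ∇u_g`, with `u_g` harmonic (`isWeakSolution_one_add_iff`). For `‖h‖ < 1` this is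
solved by a Neumann series, and the Dirichlet-to-Neumann map is
`⟨f, Λ_{1+h} g⟩ = ∫ ∇u_f · ∇u_g + ∫ h ∇u_f · ∇v`. Since `‖∇v - ∇u_g‖ = O(‖h‖)`, the map `Φ` is
Fréchet differentiable at `1`, and `⟨f, dΦ₁(h) g⟩ = ∫ h ∇u_f · ∇u_g` (`hasFDerivAt_dtn`,
`bdryPair_dtnDiff`).

*The formula.* If `η · η = 0` then `e_η` is harmonic. If `η₁`, `η₂` are isotropic with sum `-iξ`,
then `η₁ · η₂ = -|ξ|²/2`, so that `∇e_{η₁} · ∇e_{η₂} = -(|ξ|²/2) e^{-ix·ξ}`. Hence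
`⟨e_{η₁}, dΦ₁(w) e_{η₂}⟩ = -(|ξ|²/2) ℱw(ξ)` (`hasFourierValue_of_hasDtnDiff`). The Fourier transform
does not depend on how `w` is split (`IsSplitting.integral_add_pairing_eq`).

*Uniqueness.* For `d ≥ 2` every `-iξ` is a sum of two isotropic vectors, so that `ℱw(ξ)` is
determined for `ξ ≠ 0`. As `w` is continuous for the topology of some `C^N(K)`, with `K` compact, it
remains to see that in `C^N(K)` test functions are limits of linear combinations of exponentials of
nonzero frequency. By Fourier inversion a test function is an integral of exponentials, and the
integral converges as a Bochner integral in the Banach space of jets of order `N` on `K`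
(`jet_mem_closure_span_fourierExp`, `eq_of_forall_hasFourierValue`).
-/

/-! ### Approximation of test functions by exponentials -/

open Real VectorFourier FourierTransform in
/-- The derivatives of a character. Since a character is the Fourier transform of a Dirac mass, the
formula is the one for the derivatives of a Fourier integral. -/
theorem iteratedFDeriv_fourierChar_inner {E : Type*} [NormedAddCommGroup E] [InnerProductSpace ℝ E]
    [MeasurableSpace E] [BorelSpace E] [SecondCountableTopology E] (ξ : E) (n : ℕ) (x : E) :
    iteratedFDeriv ℝ n (fun y : E => (𝐞 (-(inner ℝ ξ y : ℝ)) : ℂ)) x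
      = (𝐞 (-(inner ℝ ξ x : ℝ)) : ℂ) •
        fourierPowSMulRight (innerSL ℝ) (fun _ : E => (1 : ℂ)) ξ n := by
  have hint : ∀ m : ℕ, (m : ℕ∞) ≤ (⊤ : ℕ∞) →
      Integrable (fun v : E => ‖v‖ ^ m * ‖(fun _ : E => (1 : ℂ)) v‖) (Measure.dirac ξ) :=
    fun m _ => integrable_dirac (by simp)
  have h := iteratedFDeriv_fourierIntegral (μ := Measure.dirac ξ) (innerSL ℝ)
    (f := fun _ : E => (1 : ℂ)) (N := ⊤) hint aestronglyMeasurable_const (n := n) le_top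
  have e : (fun y : E => (𝐞 (-(inner ℝ ξ y : ℝ)) : ℂ))
      = fourierIntegral 𝐞 (Measure.dirac ξ) (innerSL ℝ (E := E)).toLinearMap₁₂
        (fun _ : E => (1 : ℂ)) := by
    funext y
    simp [fourierIntegral, integral_dirac, Circle.smul_def]
  rw [e, h]
  simp only [fourierIntegral, integral_dirac]
  simp only [Circle.smul_def]
  rfl

/-- The smooth complex functions on `E`. -/
def smoothFun (E : Type*) [NormedAddCommGroup E] [NormedSpace ℝ E] : Submodule ℂ (E → ℂ) where
  carrier := {f | ContDiff ℝ ∞ f}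
  zero_mem' := contDiff_const (𝕜 := ℝ) (n := ∞) (c := (0 : ℂ))
  add_mem' := fun {f g} hf hg =>
    ContDiff.add (show ContDiff ℝ ∞ f from hf) (show ContDiff ℝ ∞ g from hg)
  smul_mem' := fun c f hf => ContDiff.const_smul c (show ContDiff ℝ ∞ f from hf)

theorem smoothFun.contDiff {E : Type*} [NormedAddCommGroup E] [NormedSpace ℝ E] (f : smoothFun E) :
    ContDiff ℝ ∞ (f : E → ℂ) :=
  f.2

section Jet

variable {E : Type*} [NormedAddCommGroup E] [InnerProductSpace ℝ E]

theorem continuous_iteratedFDeriv_smoothFun (f : smoothFun E) (n : ℕ) :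
    Continuous (iteratedFDeriv ℝ n (f : E → ℂ)) :=
  ContDiff.continuous_iteratedFDeriv (n := ∞) (by exact_mod_cast le_top) (smoothFun.contDiff f)

/-- The normed space of the families of continuous functions on `K` that may be the derivatives of
order at most `N` of a function on `E`. -/
def JetSpace (N : ℕ) (K : Set E) : Type _ := Π i : Fin (N + 1), C(K, E [×(i : ℕ)]→L[ℝ] ℂ)

noncomputable instance (N : ℕ) (K : Set E) : AddCommGroup (JetSpace N K) :=
  inferInstanceAs (AddCommGroup (Π i : Fin (N + 1), C(K, E [×(i : ℕ)]→L[ℝ] ℂ)))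

noncomputable instance (N : ℕ) (K : Set E) : Module ℂ (JetSpace N K) :=
  inferInstanceAs (Module ℂ (Π i : Fin (N + 1), C(K, E [×(i : ℕ)]→L[ℝ] ℂ)))

noncomputable instance (N : ℕ) (K : Set E) [CompactSpace K] : NormedAddCommGroup (JetSpace N K) :=
  inferInstanceAs (NormedAddCommGroup (Π i : Fin (N + 1), C(K, E [×(i : ℕ)]→L[ℝ] ℂ)))

noncomputable instance (N : ℕ) (K : Set E) [CompactSpace K] : NormedSpace ℂ (JetSpace N K) :=
  inferInstanceAs (NormedSpace ℂ (Π i : Fin (N + 1), C(K, E [×(i : ℕ)]→L[ℝ] ℂ)))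

instance (N : ℕ) (K : Set E) [CompactSpace K] : CompleteSpace (JetSpace N K) :=
  inferInstanceAs (CompleteSpace (Π i : Fin (N + 1), C(K, E [×(i : ℕ)]→L[ℝ] ℂ)))

/-- The restrictions to `K` of the derivatives of order at most `N` of a smooth function. -/
noncomputable def jet (N : ℕ) (K : Set E) :
    smoothFun E →ₗ[ℂ] JetSpace N K where
  toFun f i := ⟨fun x => iteratedFDeriv ℝ i (f : E → ℂ) x,
    (continuous_iteratedFDeriv_smoothFun f i).comp continuous_subtype_val⟩
  map_add' f g := by
    funext i
    ext1 x
    exact iteratedFDeriv_add_apply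
      (ContDiff.contDiffAt ((smoothFun.contDiff f).of_le (by exact_mod_cast le_top)))
      (ContDiff.contDiffAt ((smoothFun.contDiff g).of_le (by exact_mod_cast le_top)))
  map_smul' c f := by
    funext i
    ext1 x
    exact iteratedFDeriv_const_smul_apply
      (ContDiff.contDiffAt ((smoothFun.contDiff f).of_le (by exact_mod_cast le_top)))

theorem norm_iteratedFDeriv_le_norm_jet {N : ℕ} {K : Set E} [CompactSpace K] (f : smoothFun E)
    {i : ℕ} (hi : i ≤ N) {x : E} (hx : x ∈ K) :
    ‖iteratedFDeriv ℝ i (f : E → ℂ) x‖ ≤ ‖jet N K f‖ :=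
  (ContinuousMap.norm_coe_le_norm (jet N K f ⟨i, Nat.lt_succ_of_le hi⟩) ⟨x, hx⟩).trans
    (norm_le_pi_norm (jet N K f) ⟨i, Nat.lt_succ_of_le hi⟩)

/-- The character `x ↦ exp(-2πi ⟨ξ, x⟩)`, as a smooth function. -/
noncomputable def fourierExp (ξ : E) : smoothFun E :=
  ⟨fun x => (Real.fourierChar (-(inner ℝ ξ x : ℝ)) : ℂ), by
    change ContDiff ℝ ∞ _
    simp only [Real.fourierChar_apply]
    exact Complex.contDiff_exp.comp ((Complex.ofRealCLM.contDiff.comp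
      (contDiff_const.mul (contDiff_const.inner ℝ contDiff_id).neg)).mul contDiff_const)⟩

variable [FiniteDimensional ℝ E] [MeasurableSpace E] [BorelSpace E]

theorem continuous_jet_fourierExp (N : ℕ) (K : Set E) [CompactSpace K] :
    Continuous (fun ξ : E => jet N K (fourierExp ξ)) := by
  refine continuous_pi fun i => ?_
  have : Continuous (fun p : E × K => iteratedFDeriv ℝ i (fourierExp p.1 : E → ℂ) p.2) := by
    have e : (fun p : E × K => iteratedFDeriv ℝ i (fourierExp p.1 : E → ℂ) p.2)
      = fun p : E × K => (Real.fourierChar (-(inner ℝ p.1 (p.2 : E) : ℝ)) : ℂ) •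
        VectorFourier.fourierPowSMulRight (innerSL ℝ) (fun _ : E => (1 : ℂ)) p.1 i := by
      funext p
      exact iteratedFDeriv_fourierChar_inner p.1 i p.2
    rw [e]
    refine Continuous.smul (M := ℂ) ?_ ?_
    · simp only [Real.fourierChar_apply]
      fun_prop
    · exact ((continuous_const (y := (1 : ℂ))).fourierPowSMulRight (innerSL ℝ) i).comp
        continuous_fst
  exact (ContinuousMap.curry ⟨_, this⟩).continuous

theorem norm_jet_fourierExp_le (N : ℕ) (K : Set E) [CompactSpace K] (ξ : E) :
    ‖jet N K (fourierExp ξ)‖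
      ≤ ∑ n ∈ Finset.range (N + 1), (2 * Real.pi * ‖innerSL ℝ (E := E)‖) ^ n * ‖ξ‖ ^ n := by
  refine (pi_norm_le_iff_of_nonneg (by positivity)).2 fun i => ?_
  refine (ContinuousMap.norm_le _ (by positivity)).2 fun x => ?_
  have h : ‖iteratedFDeriv ℝ i (fourierExp ξ : E → ℂ) x‖
      ≤ (2 * Real.pi * ‖innerSL ℝ (E := E)‖) ^ (i : ℕ) * ‖ξ‖ ^ (i : ℕ) := by
    refine (congrArg norm (iteratedFDeriv_fourierChar_inner ξ i (x : E))).trans_le ?_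
    rw [norm_smul, Circle.norm_coe, one_mul]
    refine (VectorFourier.norm_fourierPowSMulRight_le _ _ _ _).trans ?_
    simp
  exact h.trans (Finset.single_le_sum
    (f := fun n : ℕ => (2 * Real.pi * ‖innerSL ℝ (E := E)‖) ^ n * ‖ξ‖ ^ n)
    (fun n _ => by positivity) (Finset.mem_range.2 i.2))

open FourierTransform in
/-- On a compact set, and together with its derivatives up to any order, a compactly supported
smooth function is a limit of linear combinations of characters of nonzero frequency: by Fourier
inversion it is a Bochner integral of characters in the space of jets. -/
theorem jet_mem_closure_span_fourierExp [Nontrivial E] (N : ℕ) (K : Set E) [CompactSpace K]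
    (f : smoothFun E) (hf : HasCompactSupport (f : E → ℂ)) :
    jet N K f ∈ (Submodule.span ℂ
      ((fun ξ : E => jet N K (fourierExp ξ)) '' {ξ | ξ ≠ 0})).topologicalClosure := by
  set S := (Submodule.span ℂ
      ((fun ξ : E => jet N K (fourierExp ξ)) '' {ξ | ξ ≠ 0})).topologicalClosure
  let ψ : SchwartzMap E ℂ := 𝓕⁻ (hf.toSchwartzMap (smoothFun.contDiff f))
  have hψ : 𝓕 (ψ : E → ℂ) = f := by
    rw [← SchwartzMap.fourier_coe, FourierTransform.fourier_fourierInv_eq]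
    rfl
  have hpow : ∀ n : ℕ, Integrable (fun v : E => ‖v‖ ^ n * ‖ψ v‖) := fun n =>
    ψ.integrable_pow_mul volume n
  have hint : Integrable (fun ξ : E => ψ ξ • jet N K (fourierExp ξ)) := by
    refine Integrable.mono' (g := fun ξ => ∑ n ∈ Finset.range (N + 1),
      (2 * Real.pi * ‖innerSL ℝ (E := E)‖) ^ n * (‖ξ‖ ^ n * ‖ψ ξ‖)) ?_ ?_ ?_
    · exact integrable_finsetSum _ fun n _ => (hpow n).const_mul _
    · exact (ψ.continuous.smul (continuous_jet_fourierExp N K)).aestronglyMeasurable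
    · refine Filter.Eventually.of_forall fun ξ => ?_
      rw [norm_smul, mul_comm]
      refine (mul_le_mul_of_nonneg_right (norm_jet_fourierExp_le N K ξ) (norm_nonneg _)).trans ?_
      rw [Finset.sum_mul]
      exact (Finset.sum_congr rfl fun n _ => by ring).le
  have key : jet N K f = ∫ ξ : E, ψ ξ • jet N K (fourierExp ξ) := by
    funext i
    ext1 x
    let ev := (ContinuousMap.evalCLM ℂ x).comp (ContinuousLinearMap.proj (R := ℂ)
      (φ := fun i : Fin (N + 1) => C(K, E [×(i : ℕ)]→L[ℝ] ℂ)) i)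
    have h1 : (∫ ξ : E, ψ ξ • jet N K (fourierExp ξ)) i x
        = ∫ ξ : E, ev (ψ ξ • jet N K (fourierExp ξ)) :=
      (ContinuousLinearMap.integral_comp_comm ev hint).symm
    rw [h1]
    change iteratedFDeriv ℝ i (f : E → ℂ) x = _
    rw [← hψ, Real.iteratedFDeriv_fourier (N := ⊤) (fun n _ => hpow n)
      ψ.continuous.aestronglyMeasurable le_top, Real.fourier_eq]
    refine integral_congr_ae (Filter.Eventually.of_forall fun ξ => ?_)
    change _ = ψ ξ • iteratedFDeriv ℝ i (fourierExp ξ : E → ℂ) x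
    refine Eq.trans ?_ (congrArg (ψ ξ • ·) (iteratedFDeriv_fourierChar_inner ξ i (x : E)).symm)
    ext m
    simp [Circle.smul_def]
    ring
  have hq : S.mkQL (∫ ξ : E, ψ ξ • jet N K (fourierExp ξ)) = 0 := by
    have hS' : IsClosed (S : Set (JetSpace N K)) := Submodule.isClosed_topologicalClosure _
    rw [← ContinuousLinearMap.integral_comp_comm S.mkQL hint]
    refine integral_eq_zero_of_ae ?_
    -- The frequency `0` is a null set, so that it may be left out of the span.
    have h0 : ∀ᵐ ξ : E, ξ ≠ 0 := by simp [ae_iff]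
    filter_upwards [h0] with ξ hξ
    refine (Submodule.Quotient.mk_eq_zero S).2 (S.smul_mem _ ?_)
    exact Submodule.le_topologicalClosure _ (Submodule.subset_span ⟨ξ, hξ, rfl⟩)
  rw [key]
  exact (Submodule.Quotient.mk_eq_zero S).1 hq

/-- A linear functional on smooth functions that is continuous for the topology of `C^N(K)` and
vanishes on all exponentials `exp(-i x·ξ)` with `ξ ≠ 0` vanishes on the test functions. -/
theorem eq_zero_of_forall_exp_eq_zero [Nontrivial E] {N : ℕ} {K : Set E} (hK : IsCompact K)
    (V : smoothFun E →ₗ[ℂ] ℂ) {C : ℝ}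
    (hV : ∀ (f : smoothFun E) (ε : ℝ), 0 ≤ ε →
      (∀ i ≤ N, ∀ x ∈ K, ‖iteratedFDeriv ℝ i (f : E → ℂ) x‖ ≤ ε) → ‖V f‖ ≤ C * ε)
    (hexp : ∀ f : smoothFun E, ∀ ξ : E, ξ ≠ 0 →
      (∀ x, (f : E → ℂ) x = Complex.exp (-Complex.I * (inner ℝ x ξ : ℝ))) → V f = 0)
    (f : smoothFun E) (hf : HasCompactSupport (f : E → ℂ)) : V f = 0 := by
  have : CompactSpace K := isCompact_iff_compactSpace.1 hK
  have hV' : ∀ g : smoothFun E, ‖V g‖ ≤ C * ‖jet N K g‖ := fun g =>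
    hV g _ (norm_nonneg _) fun i hi x hx => norm_iteratedFDeriv_le_norm_jet g hi hx
  have hspan : ∀ s ∈ Submodule.span ℂ ((fun ξ : E => jet N K (fourierExp ξ)) '' {ξ | ξ ≠ 0}),
      ∃ g : smoothFun E, jet N K g = s ∧ V g = 0 := by
    intro s hs
    induction hs using Submodule.span_induction with
    | mem s hs =>
      obtain ⟨ξ, hξ, rfl⟩ := hs
      refine ⟨_, rfl, hexp _ ((2 * Real.pi) • ξ) (smul_ne_zero (by positivity) hξ) fun x => ?_⟩
      change (Real.fourierChar (-(inner ℝ ξ x : ℝ)) : ℂ) = _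
      rw [Real.fourierChar_apply, inner_smul_right, real_inner_comm]
      congr 1
      push_cast
      ring
    | zero => exact ⟨0, map_zero _, map_zero _⟩
    | add s t _ _ h1 h2 =>
      obtain ⟨g, rfl, hg⟩ := h1
      obtain ⟨g', rfl, hg'⟩ := h2
      exact ⟨g + g', map_add _ _ _, by rw [map_add, hg, hg', add_zero]⟩
    | smul c s _ h =>
      obtain ⟨g, rfl, hg⟩ := h
      exact ⟨c • g, map_smul _ _ _, by rw [map_smul, hg, smul_zero]⟩
  have hmem := jet_mem_closure_span_fourierExp N K f hf
  obtain ⟨s, hs, hlim⟩ := mem_closure_iff_seq_limit.1 hmem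
  choose g hg hg0 using fun n => hspan (s n) (hs n)
  have hb : ∀ n, ‖V f‖ ≤ C * ‖jet N K f - s n‖ := by
    intro n
    have := hV' (f - g n)
    rwa [map_sub, map_sub, hg0, sub_zero, hg] at this
  have hl : Filter.Tendsto (fun n => C * ‖jet N K f - s n‖) Filter.atTop (nhds 0) := by
    have := ((tendsto_const_nhds (x := jet N K f)).sub hlim).norm.const_mul C
    simpa using this
  exact norm_le_zero_iff.1 (ge_of_tendsto' hl hb)

end Jet

/-! ### Compactly supported distributions -/

namespace Calderon

section Distributions

variable {d : ℕ} {Ω : Opens (Rd d)}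

theorem isFiniteMeasure_vol (hΩ : Bornology.IsBounded (Ω : Set (Rd d))) :
    IsFiniteMeasure (vol Ω) :=
  ⟨by rw [Measure.restrict_apply_univ]; exact hΩ.measure_lt_top⟩

theorem mulSmooth_apply (χ : 𝓓(Ω, ℝ)) (F : Rd d → ℝ) (hF : ContDiffOn ℝ ∞ F Ω) (x : Rd d) :
    mulSmooth χ F hF x = χ x * F x := rfl

theorem test_eq_zero {F : Type*} [NormedAddCommGroup F] [NormedSpace ℝ F] (φ : 𝓓(Ω, F)) {x : Rd d}
    (hx : x ∉ (Ω : Set (Rd d))) : φ x = 0 :=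
  image_eq_zero_of_notMem_tsupport fun h => hx (φ.tsupport_subset h)

theorem exists_test_eq_one {K : Set (Rd d)} (hK : IsCompact K) (hKΩ : K ⊆ Ω) :
    ∃ χ : 𝓓(Ω, ℝ), ∀ x ∈ K, ∀ᶠ y in nhds x, χ y = 1 := by
  obtain ⟨L, hL, hKL, hLΩ⟩ := exists_compact_between hK Ω.isOpen hKΩ
  obtain ⟨f, hf0, hf1, -⟩ := exists_contMDiffMap_zero_one_nhds_of_isClosed
    (modelWithCornersSelf ℝ (Rd d)) (n := ⊤) (isOpen_interior (s := L)).isClosed_compl hK.isClosed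
    (Set.disjoint_left.2 fun x hx hx' => hx (hKL hx'))
  have hsupp : tsupport f ⊆ L := by
    intro x hx
    by_contra hxL
    have : x ∈ (interior L)ᶜ := fun h => hxL (interior_subset h)
    exact notMem_tsupport_iff_eventuallyEq.2 (hf0.filter_mono (nhds_le_nhdsSet this)) hx
  exact ⟨⟨f, f.contMDiff.contDiff, hL.of_isClosed_subset (isClosed_tsupport _) hsupp,
    hsupp.trans hLΩ⟩, fun x hx => hf1.filter_mono (nhds_le_nhdsSet hx)⟩

theorem isCutoff_of_eq_one {K : Set (Rd d)} {T : 𝓓'(Ω, ℂ)}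
    (hT : Distribution.IsVanishingOn (⇑T) Kᶜ) {χ : 𝓓(Ω, ℝ)}
    (hχ : ∀ x ∈ K, ∀ᶠ y in nhds x, χ y = 1) : IsCutoff χ T := by
  intro φ
  rw [← sub_eq_zero, ← map_sub]
  refine hT _ fun x hx hxK => ?_
  refine notMem_tsupport_iff_eventuallyEq.2 ?_ hx
  filter_upwards [hχ x hxK] with y hy
  change χ y * φ y - φ y = 0
  rw [hy, one_mul, sub_self]

theorem IsCompactlySupported.exists_isCutoff {T : 𝓓'(Ω, ℂ)} (hT : IsCompactlySupported T) :
    ∃ χ : 𝓓(Ω, ℝ), IsCutoff χ T := by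
  obtain ⟨K, hK, hKΩ, hv⟩ := hT
  obtain ⟨χ, hχ⟩ := exists_test_eq_one hK hKΩ
  exact ⟨χ, isCutoff_of_eq_one hv hχ⟩

theorem contDiffOn_re {F : Rd d → ℂ} (hF : ContDiffOn ℝ ∞ F Ω) :
    ContDiffOn ℝ ∞ (fun x => (F x).re) Ω :=
  Complex.reCLM.contDiff.comp_contDiffOn hF

theorem contDiffOn_im {F : Rd d → ℂ} (hF : ContDiffOn ℝ ∞ F Ω) :
    ContDiffOn ℝ ∞ (fun x => (F x).im) Ω :=
  Complex.imCLM.contDiff.comp_contDiffOn hF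

theorem apply_mulSmooth_eq_of_isCutoff {T : 𝓓'(Ω, ℂ)} {χ χ' : 𝓓(Ω, ℝ)} (hχ : IsCutoff χ T)
    (hχ' : IsCutoff χ' T) (F : Rd d → ℝ) (hF : ContDiffOn ℝ ∞ F Ω) :
    T (mulSmooth χ F hF) = T (mulSmooth χ' F hF) := by
  rw [← hχ' (mulSmooth χ F hF), ← hχ (mulSmooth χ' F hF)]
  congr 1
  ext x
  simp only [mulSmooth_apply]
  ring

theorem pairing_eq {T : 𝓓'(Ω, ℂ)} {χ : 𝓓(Ω, ℝ)} (hχ : IsCutoff χ T) {F : Rd d → ℂ}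
    (hF : ContDiffOn ℝ ∞ F Ω) :
    pairing T F = T (mulSmooth χ (fun x => (F x).re) (contDiffOn_re hF))
      + Complex.I * T (mulSmooth χ (fun x => (F x).im) (contDiffOn_im hF)) := by
  have h : (∃ χ : 𝓓(Ω, ℝ), IsCutoff χ T) ∧ ContDiffOn ℝ ∞ F Ω := ⟨⟨χ, hχ⟩, hF⟩
  rw [pairing, dif_pos h]
  exact congrArg₂ (fun a b => a + Complex.I * b)
    (apply_mulSmooth_eq_of_isCutoff h.1.choose_spec hχ _ _)
    (apply_mulSmooth_eq_of_isCutoff h.1.choose_spec hχ _ _)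

theorem pairing_congr {T : 𝓓'(Ω, ℂ)} (hT : IsCompactlySupported T) {F G : Rd d → ℂ}
    (hF : ContDiffOn ℝ ∞ F Ω) (h : ∀ x ∈ Ω, F x = G x) : pairing T F = pairing T G := by
  obtain ⟨χ, hχ⟩ := hT.exists_isCutoff
  rw [pairing_eq hχ hF, pairing_eq hχ (hF.congr fun x hx => (h x hx).symm)]
  have key : ∀ x, χ x * (F x).re = χ x * (G x).re ∧ χ x * (F x).im = χ x * (G x).im := by
    intro x
    by_cases hx : x ∈ Ω
    · simp [h x hx]
    · simp [test_eq_zero χ hx]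
  refine congrArg₂ (fun a b => T a + Complex.I * T b) ?_ ?_
  · ext x
    exact (key x).1
  · ext x
    exact (key x).2

theorem pairing_add {T : 𝓓'(Ω, ℂ)} (hT : IsCompactlySupported T) {F G : Rd d → ℂ}
    (hF : ContDiffOn ℝ ∞ F Ω) (hG : ContDiffOn ℝ ∞ G Ω) :
    pairing T (F + G) = pairing T F + pairing T G := by
  obtain ⟨χ, hχ⟩ := hT.exists_isCutoff
  have hFG : ContDiffOn ℝ ∞ (F + G) Ω := hF.add hG
  rw [pairing_eq hχ hF, pairing_eq hχ hG, pairing_eq hχ hFG]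
  have e1 : mulSmooth χ (fun x => ((F + G) x).re) (contDiffOn_re hFG)
      = mulSmooth χ (fun x => (F x).re) (contDiffOn_re hF)
        + mulSmooth χ (fun x => (G x).re) (contDiffOn_re hG) := by
    ext x
    exact mul_add _ _ _
  have e2 : mulSmooth χ (fun x => ((F + G) x).im) (contDiffOn_im hFG)
      = mulSmooth χ (fun x => (F x).im) (contDiffOn_im hF)
        + mulSmooth χ (fun x => (G x).im) (contDiffOn_im hG) := by
    ext x
    exact mul_add _ _ _
  rw [e1, e2, map_add, map_add]
  ring

theorem pairing_smul {T : 𝓓'(Ω, ℂ)} (hT : IsCompactlySupported T) (c : ℂ) {F : Rd d → ℂ}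
    (hF : ContDiffOn ℝ ∞ F Ω) : pairing T (c • F) = c * pairing T F := by
  obtain ⟨χ, hχ⟩ := hT.exists_isCutoff
  have hcF : ContDiffOn ℝ ∞ (c • F) Ω := contDiffOn_const.smul hF
  rw [pairing_eq hχ hF, pairing_eq hχ hcF]
  have e1 : mulSmooth χ (fun x => ((c • F) x).re) (contDiffOn_re hcF)
      = c.re • mulSmooth χ (fun x => (F x).re) (contDiffOn_re hF)
        - c.im • mulSmooth χ (fun x => (F x).im) (contDiffOn_im hF) := by
    ext x
    change χ x * (c * F x).re = c.re * (χ x * (F x).re) - c.im * (χ x * (F x).im)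
    rw [Complex.mul_re]
    ring
  have e2 : mulSmooth χ (fun x => ((c • F) x).im) (contDiffOn_im hcF)
      = c.re • mulSmooth χ (fun x => (F x).im) (contDiffOn_im hF)
        + c.im • mulSmooth χ (fun x => (F x).re) (contDiffOn_re hF) := by
    ext x
    change χ x * (c * F x).im = c.re * (χ x * (F x).im) + c.im * (χ x * (F x).re)
    rw [Complex.mul_im]
    ring
  rw [e1, e2, map_sub, map_add, map_smul, map_smul, map_smul, map_smul]
  simp only [Complex.real_smul]
  conv_rhs => rw [← Complex.re_add_im c]
  linear_combination (-(c.im : ℂ) * T (mulSmooth χ (fun x => (F x).im) (contDiffOn_im hF))) *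
    Complex.I_mul_I

/-- A distribution restricted to the test functions supported in a given compact set has finite
order. -/
theorem exists_bound_of_tsupport_subset (T : 𝓓'(Ω, ℂ)) {K : Set (Rd d)} (hK : IsCompact K)
    (hKΩ : K ⊆ Ω) : ∃ (N : ℕ) (C : ℝ), 0 ≤ C ∧ ∀ (φ : 𝓓(Ω, ℝ)) (ε : ℝ), 0 ≤ ε → tsupport φ ⊆ K →
      (∀ i ≤ N, ∀ x ∈ K, ‖iteratedFDeriv ℝ i φ x‖ ≤ ε) → ‖T φ‖ ≤ C * ε := by
  let K' : Compacts (Rd d) := ⟨K, hK⟩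
  let A : 𝓓^{⊤}_{K'}(Rd d, ℝ) →ₗ[ℝ] ℂ :=
    { toFun := fun f => T (TestFunction.ofSupportedIn hKΩ f)
      map_add' := fun f g => map_add T (TestFunction.ofSupportedIn hKΩ f)
        (TestFunction.ofSupportedIn hKΩ g)
      map_smul' := fun c f => map_smul T c (TestFunction.ofSupportedIn hKΩ f) }
  have hA : Continuous A :=
    (ContinuousLinearMap.continuous T).comp (TestFunction.continuous_ofSupportedIn hKΩ)
  obtain ⟨s, C, -, hC⟩ := Seminorm.bound_of_continuous
    (ContDiffMapSupportedIn.withSeminorms ℝ (Rd d) ℝ ⊤ K') ((normSeminorm ℝ ℂ).comp A)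
    (continuous_norm.comp hA)
  refine ⟨s.sup id, C, C.2, fun φ ε hε hφ h => ?_⟩
  let f : 𝓓^{⊤}_{K'}(Rd d, ℝ) :=
    ContDiffMapSupportedIn.of_support_subset φ.contDiff ((subset_tsupport φ).trans hφ)
  have h1 : ‖T φ‖ ≤ C * (s.sup (ContDiffMapSupportedIn.seminorm ℝ (Rd d) ℝ ⊤ K')) f := hC f
  refine h1.trans (mul_le_mul_of_nonneg_left ?_ C.2)
  refine Seminorm.finset_sup_apply_le hε fun i hi => ?_
  exact (ContDiffMapSupportedIn.seminorm_top_le_iff ℝ hε i f).2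
    (h i (Finset.le_sup (f := id) hi))

theorem exists_bound_pairing {T : 𝓓'(Ω, ℂ)} (hT : IsCompactlySupported T) :
    ∃ (N : ℕ) (C : ℝ), 0 ≤ C ∧ ∀ (F : Rd d → ℂ) (ε : ℝ), ContDiff ℝ ∞ F → 0 ≤ ε →
      (∀ i ≤ N, ∀ x ∈ Ω, ‖iteratedFDeriv ℝ i F x‖ ≤ ε) → ‖pairing T F‖ ≤ C * ε := by
  obtain ⟨χ, hχ⟩ := hT.exists_isCutoff
  obtain ⟨N, C, hC, hb⟩ := exists_bound_of_tsupport_subset T χ.hasCompactSupport χ.tsupport_subset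
  have hA : ∀ j : ℕ, ∃ A, ∀ x, ‖iteratedFDeriv ℝ j χ x‖ ≤ A := fun j =>
    Continuous.bounded_above_of_compact_support
      (χ.contDiff.continuous_iteratedFDeriv (by exact_mod_cast le_top))
      (χ.hasCompactSupport.iteratedFDeriv j)
  choose A hA using hA
  have hA0 : ∀ j, 0 ≤ A j := fun j => (norm_nonneg _).trans (hA j 0)
  set B : ℝ := ∑ i ∈ Finset.range (N + 1), ∑ j ∈ Finset.range (i + 1), (i.choose j : ℝ) * A j
    with hB
  have key : ∀ (G : Rd d → ℝ) (hG : ContDiff ℝ ∞ G) (ε : ℝ), 0 ≤ ε →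
      (∀ i ≤ N, ∀ x ∈ Ω, ‖iteratedFDeriv ℝ i G x‖ ≤ ε) →
      ‖T (mulSmooth χ G hG.contDiffOn)‖ ≤ C * (B * ε) := by
    intro G hG ε hε h
    have hB0 : 0 ≤ B := Finset.sum_nonneg fun i _ => Finset.sum_nonneg fun j _ =>
      mul_nonneg (Nat.cast_nonneg _) (hA0 j)
    refine hb _ _ (mul_nonneg hB0 hε) tsupport_mul_subset_left fun i hi x hx => ?_
    have h1 : ‖iteratedFDeriv ℝ i (fun x => χ x * G x) x‖
        ≤ ∑ j ∈ Finset.range (i + 1),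
          (i.choose j : ℝ) * ‖iteratedFDeriv ℝ j χ x‖ * ‖iteratedFDeriv ℝ (i - j) G x‖ :=
      norm_iteratedFDeriv_mul_le (N := ∞) χ.contDiff hG x (by exact_mod_cast le_top)
    refine h1.trans ?_
    rw [hB, Finset.sum_mul]
    refine le_trans ?_ (Finset.single_le_sum (f := fun i : ℕ =>
      (∑ j ∈ Finset.range (i + 1), (i.choose j : ℝ) * A j) * ε)
      (fun n _ => mul_nonneg (Finset.sum_nonneg fun j _ =>
        mul_nonneg (Nat.cast_nonneg _) (hA0 j)) hε) (Finset.mem_range.2 (Nat.lt_succ_of_le hi)))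
    rw [Finset.sum_mul]
    refine Finset.sum_le_sum fun j _ => ?_
    refine mul_le_mul (mul_le_mul_of_nonneg_left (hA j x) (Nat.cast_nonneg _))
      (h _ ((Nat.sub_le i j).trans hi) x (χ.tsupport_subset hx)) (norm_nonneg _)
      (mul_nonneg (Nat.cast_nonneg _) (hA0 j))
  have hcomp : ∀ (L : ℂ →L[ℝ] ℝ), ‖L‖ = 1 → ∀ (F : Rd d → ℂ), ContDiff ℝ ∞ F →
      ∀ (i : ℕ) (x : Rd d),
      ‖iteratedFDeriv ℝ i (fun x => L (F x)) x‖ ≤ ‖iteratedFDeriv ℝ i F x‖ := by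
    intro L hL F hF i x
    have := L.norm_iteratedFDeriv_comp_left (n := i) (hF.contDiffAt (x := x))
      (by exact_mod_cast le_top)
    rwa [hL, one_mul] at this
  refine ⟨N, C * B + C * B, ?_, fun F ε hF hε h => ?_⟩
  · have hB0 : 0 ≤ B := Finset.sum_nonneg fun i _ => Finset.sum_nonneg fun j _ =>
      mul_nonneg (Nat.cast_nonneg _) (hA0 j)
    positivity
  rw [pairing_eq hχ hF.contDiffOn]
  refine (norm_add_le _ _).trans ?_
  rw [norm_mul, Complex.norm_I, one_mul]
  have h1 := key (fun x => (F x).re) (Complex.reCLM.contDiff.comp hF) ε hε fun i hi x hx =>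
    (hcomp Complex.reCLM Complex.reCLM_norm F hF i x).trans (h i hi x hx)
  have h2 := key (fun x => (F x).im) (Complex.imCLM.contDiff.comp hF) ε hε fun i hi x hx =>
    (hcomp Complex.imCLM Complex.imCLM_norm F hF i x).trans (h i hi x hx)
  linarith

theorem integrable_of_Lp_top (hΩ : Bornology.IsBounded (Ω : Set (Rd d))) (g : Lp ℂ ∞ (vol Ω)) :
    Integrable g (vol Ω) :=
  have := isFiniteMeasure_vol hΩ
  (Lp.memLp g).integrable le_top

theorem integrable_mul_of_continuous (hΩ : Bornology.IsBounded (Ω : Set (Rd d))) {F : Rd d → ℂ}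
    (hF : Continuous F) (g : Lp ℂ ∞ (vol Ω)) : Integrable (fun x => F x * g x) (vol Ω) := by
  obtain ⟨C, hC⟩ := hΩ.isCompact_closure.exists_bound_of_continuousOn hF.continuousOn
  refine (integrable_of_Lp_top hΩ g).bdd_mul hF.aestronglyMeasurable (c := C) ?_
  filter_upwards [ae_restrict_mem Ω.isOpen.measurableSet] with x hx
  exact hC x (subset_closure hx)

/-- The value of `g + T` at a smooth function does not depend on the way in which the distribution
is split into a bounded function `g` and a compactly supported distribution `T`: two choices of `g`
differ only on a compact subset of `Ω`, and there a cutoff function reduces the claim to test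
functions. -/
theorem IsSplitting.integral_add_pairing_eq (hΩ : Bornology.IsBounded (Ω : Set (Rd d)))
    {w : 𝓓'(Ω, ℂ)} {g g' : Lp ℂ ∞ (vol Ω)} {T T' : 𝓓'(Ω, ℂ)} (h : IsSplitting w g T)
    (h' : IsSplitting w g' T') {F : Rd d → ℂ} (hF : ContDiff ℝ ∞ F) :
    (∫ x in (Ω : Set (Rd d)), F x * g x) + pairing T F
      = (∫ x in (Ω : Set (Rd d)), F x * g' x) + pairing T' F := by
  obtain ⟨⟨K, hK, hKΩ, hv⟩, hw⟩ := h
  obtain ⟨⟨K', hK', hKΩ', hv'⟩, hw'⟩ := h'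
  obtain ⟨χ, hχ⟩ := exists_test_eq_one (hK.union hK') (Set.union_subset hKΩ hKΩ')
  have c1 : IsCutoff χ T := isCutoff_of_eq_one hv fun x hx => hχ x (Or.inl hx)
  have c2 : IsCutoff χ T' := isCutoff_of_eq_one hv' fun x hx => hχ x (Or.inr hx)
  have hgg : ∀ᵐ x ∂(vol Ω), x ∈ (Ω : Set (Rd d)) \ (K ∪ K') → g x - g' x = 0 := by
    refine IsOpen.ae_eq_zero_of_integral_contDiff_smul_eq_zero
      (Ω.isOpen.sdiff (hK.union hK').isClosed)
      (((integrable_of_Lp_top hΩ g).sub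
        (integrable_of_Lp_top hΩ g')).locallyIntegrable.locallyIntegrableOn _) fun ψ hψ hc hs => ?_
    let φ : 𝓓(Ω, ℝ) := ⟨ψ, hψ, hc, hs.trans Set.sdiff_subset⟩
    have e1 := hw φ
    have e2 := hw' φ
    rw [hv φ fun x hx hxK => (hs hx).2 (Or.inl hxK), add_zero] at e1
    rw [hv' φ fun x hx hxK => (hs hx).2 (Or.inr hxK), add_zero] at e2
    have hφ : Continuous fun x => (φ x : ℂ) := Complex.continuous_ofReal.comp φ.continuous
    calc ∫ x, ψ x • (g x - g' x) ∂(vol Ω)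
        = ∫ x, ((φ x : ℂ) * g x - (φ x : ℂ) * g' x) ∂(vol Ω) := by
          refine integral_congr_ae (Filter.Eventually.of_forall fun x => ?_)
          change ψ x • (g x - g' x) = (ψ x : ℂ) * g x - (ψ x : ℂ) * g' x
          rw [Complex.real_smul, mul_sub]
      _ = 0 := by
          rw [integral_sub (integrable_mul_of_continuous hΩ hφ g)
            (integrable_mul_of_continuous hΩ hφ g'), ← e1, ← e2, sub_self]
  have hint : ∀ ψ : Rd d → ℂ, (∀ x ∈ K ∪ K', ψ x = 0) →
      ∫ x in (Ω : Set (Rd d)), ψ x * g x = ∫ x in (Ω : Set (Rd d)), ψ x * g' x := by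
    intro ψ h0
    refine integral_congr_ae ?_
    filter_upwards [hgg, ae_restrict_mem Ω.isOpen.measurableSet] with x hx hxΩ
    by_cases hxK : x ∈ K ∪ K'
    · rw [h0 x hxK, zero_mul, zero_mul]
    · rw [sub_eq_zero.1 (hx ⟨hxΩ, hxK⟩)]
  have hreal : ∀ (a : Rd d → ℝ) (ha : ContDiff ℝ ∞ a),
      (∫ x in (Ω : Set (Rd d)), (a x : ℂ) * g x) + T (mulSmooth χ a ha.contDiffOn)
        = (∫ x in (Ω : Set (Rd d)), (a x : ℂ) * g' x) + T' (mulSmooth χ a ha.contDiffOn) := by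
    intro a ha
    have e := (hw (mulSmooth χ a ha.contDiffOn)).symm.trans (hw' (mulSmooth χ a ha.contDiffOn))
    have hac : Continuous fun x => (a x : ℂ) := Complex.continuous_ofReal.comp ha.continuous
    have hχc : Continuous fun x => ((χ x * a x : ℝ) : ℂ) :=
      Complex.continuous_ofReal.comp (χ.continuous.mul ha.continuous)
    have e' := hint (fun x => (a x : ℂ) - ((χ x * a x : ℝ) : ℂ)) fun x hx => by
      simp [(hχ x hx).self_of_nhds]
    simp only [sub_mul] at e'
    rw [integral_sub (integrable_mul_of_continuous hΩ hac g)
        (integrable_mul_of_continuous hΩ hχc g),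
      integral_sub (integrable_mul_of_continuous hΩ hac g')
        (integrable_mul_of_continuous hΩ hχc g')] at e'
    simp only [mulSmooth_apply] at e
    linear_combination e + e'
  have hsplit : ∀ g : Lp ℂ ∞ (vol Ω), ∫ x in (Ω : Set (Rd d)), F x * g x
      = (∫ x in (Ω : Set (Rd d)), ((F x).re : ℂ) * g x)
        + Complex.I * ∫ x in (Ω : Set (Rd d)), ((F x).im : ℂ) * g x := by
    intro g
    rw [← integral_const_mul, ← integral_add
      (integrable_mul_of_continuous hΩ (by fun_prop) g)
      ((integrable_mul_of_continuous hΩ (by fun_prop) g).const_mul _)]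
    refine integral_congr_ae (Filter.Eventually.of_forall fun x => ?_)
    change F x * g x = ((F x).re : ℂ) * g x + Complex.I * (((F x).im : ℂ) * g x)
    conv_lhs => rw [← Complex.re_add_im (F x)]
    ring
  rw [pairing_eq c1 hF.contDiffOn, pairing_eq c2 hF.contDiffOn, hsplit g, hsplit g']
  linear_combination hreal (fun x => (F x).re) (Complex.reCLM.contDiff.comp hF)
    + Complex.I * hreal (fun x => (F x).im) (Complex.imCLM.contDiff.comp hF)

/-- The functional `F ↦ ∫ F g + ⟨T, F⟩` on smooth functions. -/
noncomputable def splitFunctional (hΩ : Bornology.IsBounded (Ω : Set (Rd d))) (g : Lp ℂ ∞ (vol Ω))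
    {T : 𝓓'(Ω, ℂ)} (hT : IsCompactlySupported T) : smoothFun (Rd d) →ₗ[ℂ] ℂ where
  toFun F := (∫ x in (Ω : Set (Rd d)), (F : Rd d → ℂ) x * g x) + pairing T F
  map_add' F G := by
    have hF := smoothFun.contDiff F
    have hG := smoothFun.contDiff G
    rw [Submodule.coe_add, pairing_add hT hF.contDiffOn hG.contDiffOn]
    simp only [Pi.add_apply, add_mul]
    rw [integral_add (integrable_mul_of_continuous hΩ hF.continuous g)
      (integrable_mul_of_continuous hΩ hG.continuous g)]
    ring
  map_smul' c F := by
    have hF := smoothFun.contDiff F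
    rw [Submodule.coe_smul, pairing_smul hT c hF.contDiffOn]
    simp only [Pi.smul_apply, smul_eq_mul, mul_assoc, RingHom.id_apply]
    rw [integral_const_mul]
    ring

theorem exists_bound_splitFunctional (hΩ : Bornology.IsBounded (Ω : Set (Rd d)))
    (g : Lp ℂ ∞ (vol Ω)) {T : 𝓓'(Ω, ℂ)} (hT : IsCompactlySupported T) :
    ∃ (N : ℕ) (C : ℝ), 0 ≤ C ∧ ∀ (F : smoothFun (Rd d)) (ε : ℝ), 0 ≤ ε →
      (∀ i ≤ N, ∀ x ∈ closure (Ω : Set (Rd d)), ‖iteratedFDeriv ℝ i (F : Rd d → ℂ) x‖ ≤ ε) →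
      ‖splitFunctional hΩ g hT F‖ ≤ C * ε := by
  obtain ⟨N, C, hC, hb⟩ := exists_bound_pairing hT
  have hg := integrable_of_Lp_top hΩ g
  refine ⟨N, (∫ x, ‖g x‖ ∂(vol Ω)) + C, add_nonneg (integral_nonneg fun _ => norm_nonneg _) hC,
    fun F ε hε h => ?_⟩
  refine (norm_add_le _ _).trans ?_
  rw [add_mul]
  refine add_le_add ?_ (hb F ε (smoothFun.contDiff F) hε fun i hi x hx =>
    h i hi x (subset_closure hx))
  rw [← integral_mul_const]
  refine norm_integral_le_of_norm_le (hg.norm.mul_const ε) ?_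
  filter_upwards [ae_restrict_mem Ω.isOpen.measurableSet] with x hx
  rw [norm_mul, mul_comm]
  refine mul_le_mul_of_nonneg_left ?_ (norm_nonneg _)
  have := h 0 (Nat.zero_le _) x (subset_closure hx)
  rwa [norm_iteratedFDeriv_zero] at this

theorem splitFunctional_test (hΩ : Bornology.IsBounded (Ω : Set (Rd d))) {w : 𝓓'(Ω, ℂ)}
    {g : Lp ℂ ∞ (vol Ω)} {T : 𝓓'(Ω, ℂ)} (h : IsSplitting w g T) (φ : 𝓓(Ω, ℝ))
    (F : smoothFun (Rd d)) (hF : ∀ x, (F : Rd d → ℂ) x = φ x) :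
    splitFunctional hΩ g h.1 F = w φ := by
  have hF' : (F : Rd d → ℂ) = fun x => (φ x : ℂ) := funext hF
  change (∫ x in (Ω : Set (Rd d)), (F : Rd d → ℂ) x * g x) + pairing T F = w φ
  obtain ⟨χ, hχ⟩ := h.1.exists_isCutoff
  rw [h.2 φ, pairing_eq hχ (smoothFun.contDiff F).contDiffOn, ← hχ φ]
  simp only [hF']
  have e2 : mulSmooth χ (fun x => ((F : Rd d → ℂ) x).im)
      (contDiffOn_im (smoothFun.contDiff F).contDiffOn) = 0 := by
    ext x
    rw [mulSmooth_apply, hF, Complex.ofReal_im, mul_zero]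
    rfl
  have e1 : mulSmooth χ (fun x => ((F : Rd d → ℂ) x).re)
      (contDiffOn_re (smoothFun.contDiff F).contDiffOn) = mulSmooth χ φ φ.contDiff.contDiffOn := by
    ext x
    rw [mulSmooth_apply, hF, Complex.ofReal_re, mulSmooth_apply]
  simp only [hF'] at e1 e2
  rw [e1, e2, map_zero, mul_zero, add_zero]

/-- A distribution in `L^∞(Ω) + ℰ'(Ω)` is determined by the values of its Fourier transform at the
nonzero frequencies. -/
theorem eq_of_forall_hasFourierValue (hd : 1 ≤ d) (hΩ : Bornology.IsBounded (Ω : Set (Rd d)))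
    {w w' : 𝓓'(Ω, ℂ)}
    (h : ∀ ξ : Rd d, ξ ≠ 0 → ∃ z, HasFourierValue w ξ z ∧ HasFourierValue w' ξ z) : w' = w := by
  have : Nonempty (Fin d) := ⟨⟨0, hd⟩⟩
  have hnt : Nontrivial (Rd d) := inferInstance
  obtain ⟨ξ₀, hξ₀⟩ := exists_ne (0 : Rd d)
  obtain ⟨-, ⟨⟨g, T, hs⟩, -⟩, ⟨⟨g', T', hs'⟩, -⟩⟩ := h ξ₀ hξ₀
  obtain ⟨N, C, hC, hb⟩ := exists_bound_splitFunctional hΩ g hs.1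
  obtain ⟨N', C', hC', hb'⟩ := exists_bound_splitFunctional hΩ g' hs'.1
  refine DFunLike.ext _ _ fun φ => ?_
  let F : smoothFun (Rd d) := ⟨fun x => (φ x : ℂ), Complex.ofRealCLM.contDiff.comp φ.contDiff⟩
  rw [← splitFunctional_test hΩ hs φ F fun _ => rfl,
    ← splitFunctional_test hΩ hs' φ F fun _ => rfl, ← sub_eq_zero, ← LinearMap.sub_apply]
  refine eq_zero_of_forall_exp_eq_zero (N := max N N') hΩ.isCompact_closure _ (C := C' + C)
    (fun f ε hε hf => ?_) (fun f ξ hξ hf => ?_) F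
    (φ.hasCompactSupport.comp_left (g := fun r : ℝ => (r : ℂ)) Complex.ofReal_zero)
  · rw [LinearMap.sub_apply, add_mul]
    exact (norm_sub_le _ _).trans (add_le_add
      (hb' f ε hε fun i hi => hf i (hi.trans (le_max_right _ _)))
      (hb f ε hε fun i hi => hf i (hi.trans (le_max_left _ _))))
  · obtain ⟨z, h1, h2⟩ := h ξ hξ
    have hf' : (f : Rd d → ℂ) = fun x => Complex.exp (-Complex.I * (inner ℝ x ξ : ℝ)) := funext hf
    have e1 := h1.2 g T hs
    have e2 := h2.2 g' T' hs'
    rw [LinearMap.sub_apply, sub_eq_zero]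
    change (∫ x in (Ω : Set (Rd d)), (f : Rd d → ℂ) x * g' x) + pairing T' f
      = (∫ x in (Ω : Set (Rd d)), (f : Rd d → ℂ) x * g x) + pairing T f
    rw [hf']
    exact e2.trans e1.symm

end Distributions

/-! ### The Sobolev space and the Poincaré inequality -/

section Sobolev

variable {d : ℕ} {Ω : Opens (Rd d)}

/-- The Hilbert space `L²(Ω)ᵈ` of gradients. -/
abbrev L2Vec (Ω : Opens (Rd d)) : Type := PiLp 2 (fun _ : Fin d => Lp ℂ 2 (vol Ω))

/-- The gradient `H¹(Ω) → L²(Ω)ᵈ`. -/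
noncomputable def gradL (Ω : Opens (Rd d)) : H1 Ω →L[ℂ] L2Vec Ω :=
  (WithLp.sndL 2 ℂ (Lp ℂ 2 (vol Ω)) (L2Vec Ω)).comp (H1 Ω).subtypeL

theorem gradL_apply (u : H1 Ω) (i : Fin d) : gradL Ω u i = sobGrad u i := rfl

/-- The inclusion `H¹(Ω) → L²(Ω)`. -/
noncomputable def valL (Ω : Opens (Rd d)) : H1 Ω →L[ℂ] Lp ℂ 2 (vol Ω) :=
  (WithLp.fstL 2 ℂ (Lp ℂ 2 (vol Ω)) (L2Vec Ω)).comp (H1 Ω).subtypeL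

theorem norm_sq_eq_val_grad (u : H1 Ω) : ‖u‖ ^ 2 = ‖valL Ω u‖ ^ 2 + ‖gradL Ω u‖ ^ 2 :=
  WithLp.prod_norm_sq_eq_of_L2 (u : L2Jet Ω)

theorem norm_gradL_le (u : H1 Ω) : ‖gradL Ω u‖ ≤ ‖u‖ := by
  have := norm_sq_eq_val_grad u
  exact le_of_sq_le_sq (by nlinarith [sq_nonneg ‖valL Ω u‖]) (norm_nonneg _)

theorem continuous_integral_mul_real {ψ : Rd d → ℝ} (hψ : Continuous ψ) (hc : HasCompactSupport ψ) :
    Continuous (fun f : Lp ℂ 2 (vol Ω) => ∫ x in (Ω : Set (Rd d)), f x * (ψ x : ℂ)) := by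
  have h2 : MemLp (fun x => (ψ x : ℂ)) 2 (vol Ω) :=
    (Continuous.memLp_of_hasCompactSupport (μ := vol Ω) (p := 2) hψ hc).ofReal
  have h : Continuous fun f : Lp ℂ 2 (vol Ω) => (inner ℂ (h2.toLp _) f : ℂ) :=
    continuous_const.inner continuous_id
  refine h.congr fun f => ?_
  rw [L2.inner_def]
  refine integral_congr_ae ?_
  filter_upwards [h2.coeFn_toLp] with x hx
  rw [hx, RCLike.inner_apply, Complex.conj_ofReal]

theorem isClosed_H1 : IsClosed (H1 Ω : Set (L2Jet Ω)) := by
  have e : (H1 Ω : Set (L2Jet Ω)) = ⋂ (φ : 𝓓(Ω, ℝ)) (i : Fin d), {U : L2Jet Ω |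
      ∫ x in (Ω : Set (Rd d)), U.fst x * (fderiv ℝ φ x (EuclideanSpace.single i (1 : ℝ)) : ℂ)
        = - ∫ x in (Ω : Set (Rd d)), U.snd i x * (φ x : ℂ)} := by
    refine Set.ext fun U => ?_
    simp only [Set.mem_iInter]
    rfl
  rw [e]
  refine isClosed_iInter fun φ => isClosed_iInter fun i => isClosed_eq ?_ ?_
  · exact (continuous_integral_mul_real (test_deriv_continuous φ _) (test_deriv_compact φ _)).comp
      (WithLp.fstL 2 ℂ (Lp ℂ 2 (vol Ω)) (L2Vec Ω)).continuous
  · exact ((continuous_integral_mul_real φ.continuous φ.hasCompactSupport).comp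
      ((PiLp.continuous_apply 2 _ i).comp
        (WithLp.sndL 2 ℂ (Lp ℂ 2 (vol Ω)) (L2Vec Ω)).continuous)).neg

theorem eq_zero_of_valL_eq_zero (hΩ : Bornology.IsBounded (Ω : Set (Rd d))) {u : H1 Ω}
    (hu : valL Ω u = 0) : u = 0 := by
  have := isFiniteMeasure_vol hΩ
  have hg : gradL Ω u = 0 := by
    ext1 i
    refine Lp.ext ?_
    have h : ∀ᵐ x ∂(vol Ω), x ∈ (Ω : Set (Rd d)) → sobGrad u i x = 0 := by
      refine IsOpen.ae_eq_zero_of_integral_contDiff_smul_eq_zero Ω.isOpen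
        (((Lp.memLp (sobGrad u i)).integrable
          (by norm_num)).locallyIntegrable.locallyIntegrableOn _)
        fun ψ hψ hc hs => ?_
      have e := u.2 ⟨ψ, hψ, hc, hs⟩ i
      have e0 : ∫ x in (Ω : Set (Rd d)), (u : L2Jet Ω).fst x *
          (fderiv ℝ ψ x (EuclideanSpace.single i (1 : ℝ)) : ℂ) = 0 := by
        refine integral_eq_zero_of_ae ?_
        have hu' : (u : L2Jet Ω).fst = 0 := hu
        rw [hu']
        filter_upwards [Lp.coeFn_zero ℂ 2 (vol Ω)] with x hx
        rw [hx]
        exact zero_mul _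
      have e1 : (0 : ℂ) = - ∫ x in (Ω : Set (Rd d)), (u : L2Jet Ω).snd i x * (ψ x : ℂ) :=
        e0.symm.trans e
      rw [eq_comm, neg_eq_zero] at e1
      rw [← e1]
      refine integral_congr_ae (Filter.Eventually.of_forall fun x => ?_)
      change ψ x • (u : L2Jet Ω).snd i x = _
      rw [Complex.real_smul, mul_comm]
    filter_upwards [h, ae_restrict_mem Ω.isOpen.measurableSet, Lp.coeFn_zero ℂ 2 (vol Ω)]
      with x h1 h2 h3
    exact (h1 h2).trans h3.symm
  have h2 := norm_sq_eq_val_grad u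
  rw [hu, hg, norm_zero, norm_zero] at h2
  simpa using h2

theorem ofSmooth_val_ae (hΩ : Bornology.IsBounded (Ω : Set (Rd d))) {u : Rd d → ℂ}
    (hu : ContDiff ℝ ∞ u) : ∀ᵐ x ∂(vol Ω), sobVal (ofSmooth hΩ u hu) x = u x :=
  (memLp_of_continuous hΩ hu.continuous).coeFn_toLp

theorem ofSmooth_grad_ae (hΩ : Bornology.IsBounded (Ω : Set (Rd d))) {u : Rd d → ℂ}
    (hu : ContDiff ℝ ∞ u) (i : Fin d) :
    ∀ᵐ x ∂(vol Ω), sobGrad (ofSmooth hΩ u hu) i x = partialDeriv i u x :=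
  (memLp_of_continuous hΩ (partialDeriv_continuous hu i)).coeFn_toLp

theorem eq_ofSmooth_of_ae_eq (hΩ : Bornology.IsBounded (Ω : Set (Rd d))) {v : H1 Ω} {u : Rd d → ℂ}
    (hu : ContDiff ℝ ∞ u) (h : ∀ᵐ x ∂(vol Ω), sobVal v x = u x) : v = ofSmooth hΩ u hu := by
  rw [← sub_eq_zero]
  refine eq_zero_of_valL_eq_zero hΩ ?_
  rw [map_sub, sub_eq_zero]
  refine Lp.ext ?_
  filter_upwards [h, ofSmooth_val_ae hΩ hu] with x h1 h2
  exact h1.trans h2.symm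

theorem ofSmooth_mem_testSubmodule (hΩ : Bornology.IsBounded (Ω : Set (Rd d))) (φ : 𝓓(Ω, ℂ)) :
    ofSmooth hΩ φ φ.contDiff ∈ testSubmodule Ω :=
  ⟨φ, ofSmooth_val_ae hΩ φ.contDiff⟩

theorem exists_eq_ofSmooth_of_mem_testSubmodule (hΩ : Bornology.IsBounded (Ω : Set (Rd d)))
    {u : H1 Ω} (hu : u ∈ testSubmodule Ω) : ∃ φ : 𝓓(Ω, ℂ), u = ofSmooth hΩ φ φ.contDiff := by
  obtain ⟨φ, hφ⟩ := hu
  exact ⟨φ, eq_ofSmooth_of_ae_eq hΩ φ.contDiff hφ⟩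

theorem partialDeriv_test_eq_zero (φ : 𝓓(Ω, ℂ)) (i : Fin d) {x : Rd d}
    (hx : x ∉ (Ω : Set (Rd d))) : partialDeriv i φ x = 0 :=
  image_eq_zero_of_notMem_tsupport (f := fun x => fderiv ℝ φ x (EuclideanSpace.single i (1 : ℝ)))
    fun h => hx (φ.tsupport_subset (tsupport_fderiv_apply_subset ℝ _ h))

theorem integral_test_mul_partialDeriv (φ : 𝓓(Ω, ℂ)) {u : Rd d → ℂ} (hu : ContDiff ℝ ∞ u)
    (i : Fin d) :
    ∫ x in (Ω : Set (Rd d)), φ x * partialDeriv i u x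
      = - ∫ x in (Ω : Set (Rd d)), partialDeriv i φ x * u x := by
  rw [setIntegral_eq_integral_of_forall_compl_eq_zero
      (fun x hx => by simp [test_eq_zero φ hx]),
    setIntegral_eq_integral_of_forall_compl_eq_zero
      (fun x hx => by simp [partialDeriv_test_eq_zero φ i hx])]
  have c1 := partialDeriv_continuous φ.contDiff i
  have c2 : HasCompactSupport (partialDeriv i φ) :=
    φ.hasCompactSupport.fderiv_apply ℝ (EuclideanSpace.single i (1 : ℝ))
  exact integral_smul_fderiv_eq_neg_fderiv_smul_of_integrable (μ := (volume : Measure (Rd d)))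
    (𝕜 := ℂ) (f := φ) (g := u) (v := EuclideanSpace.single i (1 : ℝ))
    ((c1.mul hu.continuous).integrable_of_hasCompactSupport c2.mul_right)
    ((φ.continuous.mul (partialDeriv_continuous hu i)).integrable_of_hasCompactSupport
      φ.hasCompactSupport.mul_right)
    ((φ.continuous.mul hu.continuous).integrable_of_hasCompactSupport
      φ.hasCompactSupport.mul_right)
    (fun x _ => φ.contDiff.differentiable (by simp) x)
    (fun x _ => hu.differentiable (by simp) x)

theorem partialDeriv_conj {u : Rd d → ℂ} (hu : ContDiff ℝ ∞ u) (i : Fin d) (x : Rd d) :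
    partialDeriv i (fun y => starRingEnd ℂ (u y)) x = starRingEnd ℂ (partialDeriv i u x) := by
  have h := (Complex.conjCLE.toContinuousLinearMap.hasFDerivAt (x := u x)).comp x
    (hu.differentiable (by simp) x).hasFDerivAt
  exact congrArg (fun L => L (EuclideanSpace.single i (1 : ℝ))) h.fderiv

theorem norm_sq_eq_integral_norm_sq (f : Lp ℂ 2 (vol Ω)) :
    ‖f‖ ^ 2 = ∫ x in (Ω : Set (Rd d)), ‖f x‖ ^ 2 := by
  have h : inner ℂ f f = ∫ x in (Ω : Set (Rd d)), (inner ℂ (f x) (f x) : ℂ) := L2.inner_def f f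
  simp only [inner_self_eq_norm_sq_to_K] at h
  have h2 : ((‖f‖ ^ 2 : ℝ) : ℂ) = ((∫ x in (Ω : Set (Rd d)), ‖f x‖ ^ 2 : ℝ) : ℂ) := by
    rw [← integral_complex_ofReal]
    push_cast
    exact h
  exact_mod_cast h2

theorem contDiff_coord (i : Fin d) : ContDiff ℝ ∞ (fun x : Rd d => ((x i : ℝ) : ℂ)) :=
  Complex.ofRealCLM.contDiff.comp (EuclideanSpace.proj (𝕜 := ℝ) i).contDiff

theorem contDiff_conj {u : Rd d → ℂ} (hu : ContDiff ℝ ∞ u) :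
    ContDiff ℝ ∞ (fun x => starRingEnd ℂ (u x)) :=
  Complex.conjCLE.toContinuousLinearMap.contDiff.comp hu

theorem partialDeriv_coord_mul_conj {u : Rd d → ℂ} (hu : ContDiff ℝ ∞ u) (i : Fin d) (x : Rd d) :
    partialDeriv i (fun y => ((y i : ℝ) : ℂ) * starRingEnd ℂ (u y)) x
      = ((x i : ℝ) : ℂ) * starRingEnd ℂ (partialDeriv i u x) + starRingEnd ℂ (u x) := by
  have h1 : HasFDerivAt (fun x : Rd d => ((x i : ℝ) : ℂ))
      (Complex.ofRealCLM.comp (EuclideanSpace.proj (𝕜 := ℝ) i)) x :=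
    (Complex.ofRealCLM.comp (EuclideanSpace.proj (𝕜 := ℝ) i)).hasFDerivAt
  have h2 := ((contDiff_conj hu).differentiable (by simp) x).hasFDerivAt
  have h3 := partialDeriv_conj hu i x
  have h4 := congrArg (fun L => L (EuclideanSpace.single i (1 : ℝ))) (h1.mul h2).fderiv
  refine Eq.trans h4 ?_
  rw [← h3, partialDeriv]
  simp

/-- The Poincaré inequality for test functions. It comes from the integration by parts
`∫ |φ|² = - ∫ xᵢ ∂ᵢ|φ|²`, in which `xᵢ` is bounded on `Ω`. -/
theorem integral_norm_sq_test_le {R : ℝ} (hR : ∀ x ∈ Ω, ‖x‖ ≤ R) (φ : 𝓓(Ω, ℂ)) (i : Fin d) :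
    ∫ x in (Ω : Set (Rd d)), ‖φ x‖ ^ 2
      ≤ 4 * R ^ 2 * ∫ x in (Ω : Set (Rd d)), ‖partialDeriv i φ x‖ ^ 2 := by
  have hpc : Continuous (partialDeriv i φ) := partialDeriv_continuous φ.contDiff i
  have hps : HasCompactSupport (partialDeriv i φ) :=
    φ.hasCompactSupport.fderiv_apply ℝ (EuclideanSpace.single i (1 : ℝ))
  have hxi := contDiff_coord (d := d) i
  have hcφ := contDiff_conj φ.contDiff
  have hpd := partialDeriv_coord_mul_conj φ.contDiff i
  have hparts := integral_test_mul_partialDeriv φ (hxi.mul hcφ) i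
  simp only [hpd] at hparts
  generalize partialDeriv i φ = p at hpc hps hparts ⊢
  have isq : ∀ f : Rd d → ℂ, Continuous f → HasCompactSupport f →
      Integrable (fun x => ‖f x‖ ^ 2) (vol Ω) := by
    intro f hf hfs
    have hfs' : HasCompactSupport fun x => ‖f x‖ * ‖f x‖ := hfs.norm.mul_right
    simp only [sq]
    exact (hf.norm.mul hf.norm).integrable_of_hasCompactSupport hfs'
  have iφ := isq φ φ.continuous φ.hasCompactSupport
  have ip := isq p hpc hps
  have i1 : Integrable (fun x => φ x * (((x i : ℝ) : ℂ) * starRingEnd ℂ (p x))) (vol Ω) :=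
    Continuous.integrable_of_hasCompactSupport
      (φ.continuous.mul (hxi.continuous.mul (Complex.continuous_conj.comp hpc)))
      φ.hasCompactSupport.mul_right
  have i2 : Integrable (fun x => φ x * starRingEnd ℂ (φ x)) (vol Ω) :=
    (φ.continuous.mul hcφ.continuous).integrable_of_hasCompactSupport
      φ.hasCompactSupport.mul_right
  have i3 : Integrable (fun x => p x * (((x i : ℝ) : ℂ) * starRingEnd ℂ (φ x))) (vol Ω) :=
    Continuous.integrable_of_hasCompactSupport
      (hpc.mul (hxi.continuous.mul hcφ.continuous)) hps.mul_right
  have e : ((∫ x in (Ω : Set (Rd d)), ‖φ x‖ ^ 2 : ℝ) : ℂ)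
      = - ∫ x in (Ω : Set (Rd d)), (p x * (((x i : ℝ) : ℂ) * starRingEnd ℂ (φ x))
        + φ x * (((x i : ℝ) : ℂ) * starRingEnd ℂ (p x))) := by
    simp only [mul_add] at hparts
    rw [integral_add i1 i2] at hparts
    rw [integral_add i3 i1, ← integral_complex_ofReal]
    have : ∫ x in (Ω : Set (Rd d)), ((‖φ x‖ ^ 2 : ℝ) : ℂ)
        = ∫ x in (Ω : Set (Rd d)), φ x * starRingEnd ℂ (φ x) := by
      refine integral_congr_ae (Filter.Eventually.of_forall fun x => ?_)
      change ((‖φ x‖ ^ 2 : ℝ) : ℂ) = φ x * starRingEnd ℂ (φ x)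
      rw [Complex.mul_conj, Complex.normSq_eq_norm_sq]
    rw [this]
    linear_combination hparts
  -- the weights `1/2` and `2R²` of the arithmetic-geometric mean inequality let the first term be
  -- absorbed in the left side
  have iI : Integrable (fun x => 1 / 2 * ‖φ x‖ ^ 2 + 2 * R ^ 2 * ‖p x‖ ^ 2) (vol Ω) :=
    (iφ.const_mul (1 / 2)).add (ip.const_mul (2 * R ^ 2))
  have hle : ∫ x in (Ω : Set (Rd d)), ‖φ x‖ ^ 2
      ≤ ∫ x in (Ω : Set (Rd d)), (1 / 2 * ‖φ x‖ ^ 2 + 2 * R ^ 2 * ‖p x‖ ^ 2) := by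
    have h0 : 0 ≤ ∫ x in (Ω : Set (Rd d)), ‖φ x‖ ^ 2 := integral_nonneg fun _ => by positivity
    have h1 : ‖((∫ x in (Ω : Set (Rd d)), ‖φ x‖ ^ 2 : ℝ) : ℂ)‖
        = ∫ x in (Ω : Set (Rd d)), ‖φ x‖ ^ 2 := by
      rw [Complex.norm_real, Real.norm_of_nonneg h0]
    rw [← h1, e, norm_neg]
    refine norm_integral_le_of_norm_le iI ?_
    filter_upwards [ae_restrict_mem Ω.isOpen.measurableSet] with x hx
    have hx1 : |x i| ≤ R := (PiLp.norm_apply_le x i).trans (hR x hx)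
    have hx2 : ‖p x * (((x i : ℝ) : ℂ) * starRingEnd ℂ (φ x))
        + φ x * (((x i : ℝ) : ℂ) * starRingEnd ℂ (p x))‖ ≤ 2 * (|x i| * (‖φ x‖ * ‖p x‖)) := by
      refine (norm_add_le _ _).trans (le_of_eq ?_)
      simp only [norm_mul, RCLike.norm_conj, Complex.norm_real, Real.norm_eq_abs]
      ring
    have hx3 : |x i| * (‖φ x‖ * ‖p x‖) ≤ R * (‖φ x‖ * ‖p x‖) :=
      mul_le_mul_of_nonneg_right hx1 (by positivity)
    have hx4 := sq_nonneg (‖φ x‖ - 2 * R * ‖p x‖)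
    have hx5 : (‖φ x‖ - 2 * R * ‖p x‖) ^ 2
        = ‖φ x‖ ^ 2 - 4 * (R * (‖φ x‖ * ‖p x‖)) + 4 * R ^ 2 * ‖p x‖ ^ 2 := by ring
    linarith
  rw [integral_add (iφ.const_mul (1 / 2)) (ip.const_mul (2 * R ^ 2)),
    integral_const_mul, integral_const_mul] at hle
  linarith

/-- The Poincaré inequality on `H¹₀(Ω)`. -/
theorem exists_poincare (hd : 1 ≤ d) (hΩ : Bornology.IsBounded (Ω : Set (Rd d))) :
    ∃ C : ℝ, ∀ u ∈ H10 Ω, ‖valL Ω u‖ ≤ C * ‖gradL Ω u‖ := by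
  obtain ⟨R, hR⟩ := hΩ.exists_norm_le
  let i : Fin d := ⟨0, hd⟩
  refine ⟨2 * |R|, fun u hu => ?_⟩
  have hcl : IsClosed {u : H1 Ω | ‖valL Ω u‖ ≤ 2 * |R| * ‖gradL Ω u‖} :=
    isClosed_le (valL Ω).continuous.norm (continuous_const.mul (gradL Ω).continuous.norm)
  refine hcl.closure_subset_iff.2 ?_ hu
  intro v hv
  obtain ⟨φ, rfl⟩ := exists_eq_ofSmooth_of_mem_testSubmodule hΩ hv
  have h := integral_norm_sq_test_le hR φ i
  have e1 : ‖valL Ω (ofSmooth hΩ φ φ.contDiff)‖ ^ 2 = ∫ x in (Ω : Set (Rd d)), ‖φ x‖ ^ 2 := by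
    rw [norm_sq_eq_integral_norm_sq]
    refine integral_congr_ae ?_
    filter_upwards [ofSmooth_val_ae hΩ φ.contDiff] with x hx
    exact congrArg (fun z : ℂ => ‖z‖ ^ 2) hx
  have e2 : ‖sobGrad (ofSmooth hΩ φ φ.contDiff) i‖ ^ 2
      = ∫ x in (Ω : Set (Rd d)), ‖partialDeriv i φ x‖ ^ 2 := by
    rw [norm_sq_eq_integral_norm_sq]
    refine integral_congr_ae ?_
    filter_upwards [ofSmooth_grad_ae hΩ φ.contDiff i] with x hx
    exact congrArg (fun z : ℂ => ‖z‖ ^ 2) hx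
  rw [← e1, ← e2] at h
  have h3 : ‖sobGrad (ofSmooth hΩ φ φ.contDiff) i‖ ≤ ‖gradL Ω (ofSmooth hΩ φ φ.contDiff)‖ :=
    PiLp.norm_apply_le (gradL Ω (ofSmooth hΩ φ φ.contDiff)) i
  have h4 : ‖valL Ω (ofSmooth hΩ φ φ.contDiff)‖
      ≤ 2 * |R| * ‖sobGrad (ofSmooth hΩ φ φ.contDiff) i‖ := by
    refine le_of_sq_le_sq ?_ (by positivity)
    rw [mul_pow, mul_pow, sq_abs]
    linarith
  exact h4.trans (mul_le_mul_of_nonneg_left h3 (by positivity))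

/-- The gradients of the functions in `H¹₀(Ω)`. -/
noncomputable def gradH10 (Ω : Opens (Rd d)) : Submodule ℂ (L2Vec Ω) :=
  (H10 Ω).map (gradL Ω).toLinearMap

theorem gradL_mem_gradH10 {u : H1 Ω} (hu : u ∈ H10 Ω) : gradL Ω u ∈ gradH10 Ω :=
  Submodule.mem_map_of_mem hu

theorem eq_zero_of_mem_H10_of_gradL_eq_zero (hd : 1 ≤ d)
    (hΩ : Bornology.IsBounded (Ω : Set (Rd d))) {u : H1 Ω} (hu : u ∈ H10 Ω)
    (h : gradL Ω u = 0) : u = 0 := by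
  obtain ⟨C, hC⟩ := exists_poincare hd hΩ
  have h1 := hC u hu
  rw [h, norm_zero, mul_zero] at h1
  exact eq_zero_of_valL_eq_zero hΩ (norm_le_zero_iff.1 h1)

theorem isClosed_gradH10 (hd : 1 ≤ d) (hΩ : Bornology.IsBounded (Ω : Set (Rd d))) :
    IsClosed (gradH10 Ω : Set (L2Vec Ω)) := by
  obtain ⟨C, hC⟩ := exists_poincare hd hΩ
  have hcompl : CompleteSpace (H1 Ω) := isClosed_H1.completeSpace_coe
  have : CompleteSpace (H10 Ω) := (isClosed_H10 Ω).completeSpace_coe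
  let A : H10 Ω →L[ℂ] L2Vec Ω := (gradL Ω).comp (H10 Ω).subtypeL
  have hA : AntilipschitzWith (Real.toNNReal (|C| + 1)) A := by
    refine AddMonoidHomClass.antilipschitz_of_bound A fun u => ?_
    rw [Real.coe_toNNReal _ (by positivity)]
    have h1 := hC u u.2
    have h2 := norm_sq_eq_val_grad (u : H1 Ω)
    have h3 : ‖valL Ω (u : H1 Ω)‖ ≤ |C| * ‖gradL Ω (u : H1 Ω)‖ :=
      h1.trans (mul_le_mul_of_nonneg_right (le_abs_self C) (norm_nonneg _))
    refine le_of_sq_le_sq ?_ (by positivity)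
    change ‖(u : H1 Ω)‖ ^ 2 ≤ ((|C| + 1) * ‖gradL Ω (u : H1 Ω)‖) ^ 2
    rw [h2]
    nlinarith [norm_nonneg (valL Ω (u : H1 Ω)), norm_nonneg (gradL Ω (u : H1 Ω)), abs_nonneg C,
      mul_nonneg (abs_nonneg C) (sq_nonneg ‖gradL Ω (u : H1 Ω)‖)]
  have hcl := hA.isClosed_range A.uniformContinuous
  have he : (gradH10 Ω : Set (L2Vec Ω)) = Set.range A := by
    refine Set.ext fun G => ⟨?_, ?_⟩
    · rintro ⟨u, hu, rfl⟩
      exact ⟨⟨u, hu⟩, rfl⟩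
    · rintro ⟨u, rfl⟩
      exact ⟨u, u.2, rfl⟩
  rw [he]
  exact hcl

end Sobolev

/-! ### Linearization of the Dirichlet-to-Neumann map -/

section Linearization

variable {d : ℕ} {Ω : Opens (Rd d)}

/-- Complex conjugation on `L²(Ω)ᵈ`. -/
noncomputable def conjL (Ω : Opens (Rd d)) : L2Vec Ω →L⋆[ℂ] L2Vec Ω where
  toFun G := WithLp.toLp 2 fun i => ((starL ℂ : ℂ ≃L⋆[ℂ] ℂ) : ℂ →L⋆[ℂ] ℂ).compLpL 2 (vol Ω) (G i)
  map_add' G H := by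
    ext1 i
    exact map_add _ (G i) (H i)
  map_smul' c G := by
    ext1 i
    exact map_smulₛₗ (((starL ℂ : ℂ ≃L⋆[ℂ] ℂ) : ℂ →L⋆[ℂ] ℂ).compLpL 2 (vol Ω)) c (G i)
  cont := (PiLp.continuous_toLp 2 _).comp (continuous_pi fun i =>
    (ContinuousLinearMap.continuous _).comp (PiLp.continuous_apply 2 _ i))

theorem conjL_ae (G : L2Vec Ω) (i : Fin d) :
    ∀ᵐ x ∂(vol Ω), conjL Ω G i x = starRingEnd ℂ (G i x) :=
  ContinuousLinearMap.coeFn_compLpL (p := 2) ((starL ℂ : ℂ ≃L⋆[ℂ] ℂ) : ℂ →L⋆[ℂ] ℂ) (G i)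

theorem norm_conjL (G : L2Vec Ω) : ‖conjL Ω G‖ = ‖G‖ := by
  have h : ∀ i, ‖conjL Ω G i‖ = ‖G i‖ := fun i => by
    refine le_antisymm (Lp.norm_le_norm_of_ae_le ?_) (Lp.norm_le_norm_of_ae_le ?_)
    all_goals
      filter_upwards [conjL_ae G i] with x hx
      rw [hx, RCLike.norm_conj]
  rw [PiLp.norm_eq_of_L2, PiLp.norm_eq_of_L2]
  simp only [h]

/-- The bilinear form `∫_Ω G · H dx` on `L²(Ω)ᵈ`. -/
noncomputable def dotL (Ω : Opens (Rd d)) : L2Vec Ω →ₗ[ℂ] L2Vec Ω →ₗ[ℂ] ℂ :=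
  LinearMap.mk₂ ℂ (fun G H => inner ℂ (conjL Ω G) H)
    (fun G G' H => by rw [map_add, inner_add_left])
    (fun c G H => by rw [map_smulₛₗ, inner_smul_left, starRingEnd_self_apply, smul_eq_mul])
    (fun G H H' => inner_add_right _ _ _)
    (fun c G H => inner_smul_right _ _ _)

theorem dotL_apply (G H : L2Vec Ω) : dotL Ω G H = inner ℂ (conjL Ω G) H := rfl

theorem norm_dotL_le (G H : L2Vec Ω) : ‖dotL Ω G H‖ ≤ ‖G‖ * ‖H‖ := by
  rw [dotL_apply, ← norm_conjL G]
  exact norm_inner_le_norm _ _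

theorem integrable_mul_L2 (f g : Lp ℂ 2 (vol Ω)) : Integrable (fun x => f x * g x) (vol Ω) :=
  MemLp.integrable_mul (Lp.memLp f) (Lp.memLp g)

theorem dotL_eq_integral (G H : L2Vec Ω) :
    dotL Ω G H = ∫ x in (Ω : Set (Rd d)), ∑ i, G i x * H i x := by
  rw [dotL_apply, PiLp.inner_apply, integral_finsetSum _ fun i _ => integrable_mul_L2 (G i) (H i)]
  refine Finset.sum_congr rfl fun i _ => ?_
  rw [L2.inner_def]
  refine integral_congr_ae ?_
  filter_upwards [conjL_ae G i] with x hx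
  rw [hx, RCLike.inner_apply, starRingEnd_self_apply, mul_comm]

theorem dotL_comm (G H : L2Vec Ω) : dotL Ω G H = dotL Ω H G := by
  rw [dotL_eq_integral, dotL_eq_integral]
  simp only [mul_comm]

theorem lpSMul_smul_comm (h : Lp ℝ ∞ (vol Ω)) (c : ℂ) (f : Lp ℂ 2 (vol Ω)) :
    (h • (c • f) : Lp ℂ 2 (vol Ω)) = c • (h • f : Lp ℂ 2 (vol Ω)) := by
  refine Lp.ext ?_
  filter_upwards [Lp.coeFn_lpSMul (r := 2) h (c • f), Lp.coeFn_lpSMul (r := 2) h f,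
    Lp.coeFn_smul c f, Lp.coeFn_smul c (h • f : Lp ℂ 2 (vol Ω))] with x h1 h2 h3 h4
  rw [h1, h4, Pi.smul_apply', h3, Pi.smul_apply, Pi.smul_apply, h2, Pi.smul_apply', smul_comm]

/-- Multiplication by a bounded real function on `L²(Ω)ᵈ`. -/
noncomputable def mulL (h : Lp ℝ ∞ (vol Ω)) : L2Vec Ω →L[ℂ] L2Vec Ω :=
  LinearMap.mkContinuous
    { toFun := fun G => WithLp.toLp 2 fun i => (h • G i : Lp ℂ 2 (vol Ω))
      map_add' := fun G H => by
        ext1 i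
        exact Lp.add_smul h (G i) (H i)
      map_smul' := fun c G => by
        ext1 i
        exact lpSMul_smul_comm h c (G i) } ‖h‖ (fun G => by
    rw [← Real.sqrt_sq (norm_nonneg h), PiLp.norm_eq_of_L2, PiLp.norm_eq_of_L2,
      ← Real.sqrt_mul (sq_nonneg _), Finset.mul_sum]
    refine Real.sqrt_le_sqrt (Finset.sum_le_sum fun i _ => ?_)
    rw [← mul_pow]
    exact pow_le_pow_left₀ (norm_nonneg _) (Lp.norm_smul_le h (G i)) 2)

theorem norm_mulL_le (h : Lp ℝ ∞ (vol Ω)) : ‖mulL h‖ ≤ ‖h‖ :=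
  LinearMap.mkContinuous_norm_le _ (norm_nonneg h) _

theorem norm_mulL_apply_le (h : Lp ℝ ∞ (vol Ω)) (G : L2Vec Ω) : ‖mulL h G‖ ≤ ‖h‖ * ‖G‖ :=
  (mulL h).le_of_opNorm_le (norm_mulL_le h) G

theorem mulL_ae (h : Lp ℝ ∞ (vol Ω)) (G : L2Vec Ω) (i : Fin d) :
    ∀ᵐ x ∂(vol Ω), mulL h G i x = (h x : ℂ) * G i x := by
  filter_upwards [Lp.coeFn_lpSMul (r := 2) h (G i)] with x hx
  exact hx.trans (Complex.real_smul)

theorem mulL_add (h k : Lp ℝ ∞ (vol Ω)) : mulL (h + k) = mulL h + mulL k := by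
  ext1 G
  ext1 i
  exact Lp.smul_add h k (G i)

theorem mulL_smul (c : ℝ) (h : Lp ℝ ∞ (vol Ω)) : mulL (c • h) = (c : ℂ) • mulL h := by
  ext1 G
  ext1 i
  refine Lp.ext ?_
  filter_upwards [mulL_ae (c • h) G i, mulL_ae h G i, Lp.coeFn_smul c h,
    Lp.coeFn_smul (c : ℂ) (mulL h G i)] with x h1 h2 h3 h4
  refine h1.trans (Eq.trans ?_ h4.symm)
  rw [h3, Pi.smul_apply, Pi.smul_apply, h2, smul_eq_mul, smul_eq_mul, Complex.ofReal_mul, mul_assoc]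

theorem mulL_oneCond : mulL (oneCond Ω) = 1 := by
  ext1 G
  ext1 i
  refine Lp.ext ?_
  have h1 : ∀ᵐ x ∂(vol Ω), oneCond Ω x = 1 := (memLp_top_const (1 : ℝ)).coeFn_toLp
  filter_upwards [mulL_ae (oneCond Ω) G i, h1] with x hx h1
  rw [hx, h1, Complex.ofReal_one, one_mul]
  rfl

theorem dotL_mulL_eq_integral (h : Lp ℝ ∞ (vol Ω)) (G H : L2Vec Ω) :
    dotL Ω G (mulL h H) = ∫ x in (Ω : Set (Rd d)), (h x : ℂ) * ∑ i, G i x * H i x := by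
  rw [dotL_eq_integral]
  refine integral_congr_ae ?_
  filter_upwards [ae_all_iff.2 (mulL_ae h H)] with x hx
  rw [Finset.mul_sum]
  refine Finset.sum_congr rfl fun i _ => ?_
  rw [hx i]
  ring

theorem energy_eq_dotL (γ : Lp ℝ ∞ (vol Ω)) (u v : H1 Ω) :
    energy γ u v = dotL Ω (gradL Ω u) (mulL γ (gradL Ω v)) :=
  (dotL_mulL_eq_integral γ (gradL Ω u) (gradL Ω v)).symm

/-- The closure of the space of gradients of `H¹₀(Ω)` functions. (By the Poincaré inequality the
space of gradients is already closed if `Ω` is bounded.) -/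
noncomputable def gradSpace (Ω : Opens (Rd d)) : Submodule ℂ (L2Vec Ω) :=
  (gradH10 Ω).topologicalClosure

instance : (gradSpace Ω).HasOrthogonalProjection :=
  inferInstanceAs (gradH10 Ω).topologicalClosure.HasOrthogonalProjection

/-- The orthogonal projection of `L²(Ω)ᵈ` onto the gradients of `H¹₀(Ω)` functions. -/
noncomputable def projL (Ω : Opens (Rd d)) : L2Vec Ω →L[ℂ] L2Vec Ω := (gradSpace Ω).starProjection

theorem gradL_mem_gradSpace {u : H1 Ω} (hu : u ∈ H10 Ω) : gradL Ω u ∈ gradSpace Ω :=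
  Submodule.le_topologicalClosure _ (gradL_mem_gradH10 hu)

theorem exists_gradL_eq_of_mem_gradSpace (hd : 1 ≤ d) (hΩ : Bornology.IsBounded (Ω : Set (Rd d)))
    {G : L2Vec Ω} (hG : G ∈ gradSpace Ω) : ∃ u ∈ H10 Ω, gradL Ω u = G := by
  have h : G ∈ (gradH10 Ω).topologicalClosure := hG
  rw [(isClosed_gradH10 hd hΩ).submodule_topologicalClosure_eq] at h
  exact h

theorem conjL_gradL_ofSmooth (hΩ : Bornology.IsBounded (Ω : Set (Rd d))) {u : Rd d → ℂ}
    (hu : ContDiff ℝ ∞ u) : conjL Ω (gradL Ω (ofSmooth hΩ u hu))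
      = gradL Ω (ofSmooth hΩ (fun x => starRingEnd ℂ (u x)) (contDiff_conj hu)) := by
  ext1 i
  refine Lp.ext ?_
  filter_upwards [conjL_ae (gradL Ω (ofSmooth hΩ u hu)) i, ofSmooth_grad_ae hΩ hu i,
    ofSmooth_grad_ae hΩ (contDiff_conj hu) i] with x h1 h2 h3
  rw [h1, gradL_apply, gradL_apply, h2, h3, partialDeriv_conj hu]

theorem conjL_mem_gradSpace (hΩ : Bornology.IsBounded (Ω : Set (Rd d))) {G : L2Vec Ω}
    (hG : G ∈ gradSpace Ω) : conjL Ω G ∈ gradSpace Ω := by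
  have hcl : IsClosed (gradSpace Ω : Set (L2Vec Ω)) := Submodule.isClosed_topologicalClosure _
  have h1 : ∀ u ∈ H10 Ω, conjL Ω (gradL Ω u) ∈ gradSpace Ω := by
    intro u hu
    have hc : IsClosed {u : H1 Ω | conjL Ω (gradL Ω u) ∈ gradSpace Ω} :=
      hcl.preimage ((conjL Ω).continuous.comp (gradL Ω).continuous)
    refine hc.closure_subset_iff.2 ?_ hu
    intro v hv
    obtain ⟨φ, rfl⟩ := exists_eq_ofSmooth_of_mem_testSubmodule hΩ hv
    change conjL Ω (gradL Ω _) ∈ gradSpace Ω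
    rw [conjL_gradL_ofSmooth]
    let ψ : 𝓓(Ω, ℂ) := ⟨fun x => starRingEnd ℂ (φ x), contDiff_conj φ.contDiff,
      φ.hasCompactSupport.comp_left (map_zero _),
      (tsupport_comp_subset (map_zero (starRingEnd ℂ)) φ).trans φ.tsupport_subset⟩
    exact gradL_mem_gradSpace (Submodule.le_topologicalClosure _ (ofSmooth_mem_testSubmodule hΩ ψ))
  refine (hcl.preimage (conjL Ω).continuous).closure_subset_iff.2 ?_ hG
  rintro _ ⟨u, hu, rfl⟩
  exact h1 u hu

theorem projL_apply_mem (G : L2Vec Ω) : projL Ω G ∈ gradSpace Ω :=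
  Submodule.starProjection_apply_mem _ _

theorem projL_eq_self {G : L2Vec Ω} (hG : G ∈ gradSpace Ω) : projL Ω G = G :=
  Submodule.starProjection_eq_self_iff.2 hG

theorem norm_projL_le : ‖projL Ω‖ ≤ 1 := Submodule.starProjection_norm_le _

theorem norm_projL_apply_le (G : L2Vec Ω) : ‖projL Ω G‖ ≤ ‖G‖ :=
  ((projL Ω).le_of_opNorm_le norm_projL_le G).trans_eq (one_mul _)

theorem projL_eq_zero_iff {G : L2Vec Ω} : projL Ω G = 0 ↔ G ∈ (gradSpace Ω)ᗮ :=
  Submodule.starProjection_apply_eq_zero_iff _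

theorem dotL_eq_zero (hΩ : Bornology.IsBounded (Ω : Set (Rd d))) {G H : L2Vec Ω}
    (hG : G ∈ gradSpace Ω) (hH : projL Ω H = 0) : dotL Ω G H = 0 :=
  (Submodule.mem_orthogonal _ _).1 (projL_eq_zero_iff.1 hH) _ (conjL_mem_gradSpace hΩ hG)

theorem isWeakSolution_iff (hΩ : Bornology.IsBounded (Ω : Set (Rd d))) {γ : Lp ℝ ∞ (vol Ω)}
    {u : H1 Ω} : IsWeakSolution γ u ↔ projL Ω (mulL γ (gradL Ω u)) = 0 := by
  refine ⟨fun h => ?_, fun h φ hφ => ?_⟩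
  · rw [projL_eq_zero_iff, Submodule.mem_orthogonal]
    have hc : IsClosed {G : L2Vec Ω | dotL Ω G (mulL γ (gradL Ω u)) = 0} :=
      isClosed_eq ((conjL Ω).continuous.inner continuous_const) continuous_const
    have hsub : ∀ G ∈ gradSpace Ω, dotL Ω G (mulL γ (gradL Ω u)) = 0 := by
      intro G hG
      refine hc.closure_subset_iff.2 ?_ hG
      rintro _ ⟨φ, hφ, rfl⟩
      exact (energy_eq_dotL γ φ u).symm.trans (h φ hφ)
    intro G hG
    have h1 := hsub _ (conjL_mem_gradSpace hΩ hG)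
    have h2 : conjL Ω (conjL Ω G) = G := by
      ext1 i
      refine Lp.ext ?_
      filter_upwards [conjL_ae (conjL Ω G) i, conjL_ae G i] with x h1 h2
      rw [h1, h2, starRingEnd_self_apply]
    rwa [dotL_apply, h2] at h1
  · rw [energy_eq_dotL]
    exact dotL_eq_zero hΩ (gradL_mem_gradSpace hφ) h

/-- `f ↦ ∇u_f`, where `u_f` is the harmonic function with boundary value `f`. -/
noncomputable def harmGrad (Ω : Opens (Rd d)) : Hhalf Ω →ₗ[ℂ] L2Vec Ω :=
  (H10 Ω).liftQ ((gradL Ω - (projL Ω).comp (gradL Ω)).toLinearMap) fun u hu => by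
    rw [LinearMap.mem_ker]
    change gradL Ω u - projL Ω (gradL Ω u) = 0
    rw [projL_eq_self (gradL_mem_gradSpace hu), sub_self]

theorem harmGrad_bdry (u : H1 Ω) :
    harmGrad Ω (bdry u) = gradL Ω u - projL Ω (gradL Ω u) := rfl

theorem bdry_surjective : Function.Surjective (bdry : H1 Ω →ₗ[ℂ] Hhalf Ω) :=
  (H10 Ω).mkQ_surjective

theorem bdry_eq_zero_iff {u : H1 Ω} : bdry u = 0 ↔ u ∈ H10 Ω :=
  Submodule.Quotient.mk_eq_zero (H10 Ω)

theorem projL_projL (G : L2Vec Ω) : projL Ω (projL Ω G) = projL Ω G :=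
  projL_eq_self (projL_apply_mem G)

theorem projL_harmGrad (f : Hhalf Ω) : projL Ω (harmGrad Ω f) = 0 := by
  obtain ⟨u, rfl⟩ := bdry_surjective f
  rw [harmGrad_bdry, map_sub, projL_projL, sub_self]

theorem norm_harmGrad_le (f : Hhalf Ω) : ‖harmGrad Ω f‖ ≤ ‖f‖ := by
  refine le_of_forall_pos_le_add fun ε hε => ?_
  obtain ⟨u, rfl, hu⟩ : ∃ u : H1 Ω, bdry u = f ∧ ‖u‖ < ‖f‖ + ε :=
    Submodule.Quotient.norm_mk_lt (S := H10 Ω) f hε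
  refine le_trans ?_ hu.le
  refine le_trans ?_ (norm_gradL_le u)
  have h : ‖gradL Ω u - projL Ω (gradL Ω u)‖ ≤ ‖gradL Ω u‖ := by
    have := (gradSpace Ω)ᗮ.starProjection_norm_le
    change ‖gradL Ω u - (gradSpace Ω).starProjection (gradL Ω u)‖ ≤ _
    rw [← Submodule.starProjection_orthogonal_val]
    exact ((gradSpace Ω)ᗮ.starProjection.le_of_opNorm_le this _).trans_eq (one_mul _)
  exact h

end Linearization

/-! ### The differential of the Dirichlet-to-Neumann map at `1` -/

section Differential

variable {d : ℕ} {Ω : Opens (Rd d)}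

/-- The operator `H^{1/2}(∂Ω) → H^{-1/2}(∂Ω)` of a bounded bilinear form on `H^{1/2}(∂Ω)`. -/
noncomputable def opOfBilin (b : Hhalf Ω →ₗ[ℂ] Hhalf Ω →ₗ[ℂ] ℂ) (C : ℝ)
    (hb : ∀ f g, ‖b f g‖ ≤ C * ‖f‖ * ‖g‖) : BdryOp Ω :=
  (show Hhalf Ω →L[ℂ] (Hhalf Ω →L[ℂ] ℂ) from LinearMap.mkContinuous₂ b.flip C fun g f => by
    rw [LinearMap.flip_apply, mul_right_comm]
    exact hb f g)

theorem bdryPair_opOfBilin (b : Hhalf Ω →ₗ[ℂ] Hhalf Ω →ₗ[ℂ] ℂ) (C : ℝ)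
    (hb : ∀ f g, ‖b f g‖ ≤ C * ‖f‖ * ‖g‖) (f g : Hhalf Ω) :
    bdryPair f (opOfBilin b C hb g) = b f g := rfl

theorem bdryOp_ext {A B : BdryOp Ω} (h : ∀ f g, bdryPair f (A g) = bdryPair f (B g)) : A = B :=
  ContinuousLinearMap.ext fun g => show (show Hhalf Ω →L[ℂ] ℂ from A g) = B g from
    ContinuousLinearMap.ext fun f => h f g

theorem norm_bdryOp_le {A : BdryOp Ω} {C : ℝ} (hC : 0 ≤ C)
    (h : ∀ f g, ‖bdryPair f (A g)‖ ≤ C * ‖f‖ * ‖g‖) : ‖A‖ ≤ C := by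
  refine ContinuousLinearMap.opNorm_le_bound _ hC fun g => ?_
  change ‖(show Hhalf Ω →L[ℂ] ℂ from A g)‖ ≤ _
  refine ContinuousLinearMap.opNorm_le_bound _ (by positivity) fun f => ?_
  rw [mul_right_comm]
  exact h f g

/-- The operator `1 + P h`, with `P` the orthogonal projection onto the gradients of `H¹₀(Ω)`
functions. It maps `∇u` to the gradient of the harmonic function with the boundary value of `u`, for
a solution `u` of `∇·((1 + h)∇u) = 0`. -/
noncomputable def pertOp (h : Lp ℝ ∞ (vol Ω)) : L2Vec Ω →L[ℂ] L2Vec Ω := 1 + projL Ω * mulL h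

theorem isUnit_pertOp {h : Lp ℝ ∞ (vol Ω)} (hh : ‖h‖ < 1) : IsUnit (pertOp h) := by
  have : ‖-(projL Ω * mulL h)‖ < 1 := by
    rw [norm_neg]
    refine (norm_mul_le _ _).trans_lt ?_
    refine lt_of_le_of_lt ?_ hh
    exact (mul_le_mul norm_projL_le (norm_mulL_le h) (norm_nonneg _) zero_le_one).trans_eq
      (one_mul _)
  rw [pertOp, ← sub_neg_eq_add]
  exact isUnit_one_sub_of_norm_lt_one this

/-- The operator that maps the gradient of a harmonic function to the gradient of the solution of
`∇·((1 + h)∇u) = 0` with the same boundary value. -/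
noncomputable def solOp (h : Lp ℝ ∞ (vol Ω)) : L2Vec Ω →L[ℂ] L2Vec Ω := Ring.inverse (pertOp h)

theorem solOp_add {h : Lp ℝ ∞ (vol Ω)} (hh : ‖h‖ < 1) (G : L2Vec Ω) :
    solOp h G + projL Ω (mulL h (solOp h G)) = G :=
  congrArg (fun A : L2Vec Ω →L[ℂ] L2Vec Ω => A G) (Ring.mul_inverse_cancel _ (isUnit_pertOp hh))

theorem solOp_eq_of_add_eq {h : Lp ℝ ∞ (vol Ω)} (hh : ‖h‖ < 1) {G V : L2Vec Ω}
    (hV : V + projL Ω (mulL h V) = G) : solOp h G = V := by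
  rw [← hV]
  exact congrArg (fun A : L2Vec Ω →L[ℂ] L2Vec Ω => A V)
    (Ring.inverse_mul_cancel _ (isUnit_pertOp hh))

theorem isWeakSolution_one_add_iff (hΩ : Bornology.IsBounded (Ω : Set (Rd d)))
    {h : Lp ℝ ∞ (vol Ω)} (hh : ‖h‖ < 1) {u : H1 Ω} :
    IsWeakSolution (oneCond Ω + h) u ↔ gradL Ω u = solOp h (harmGrad Ω (bdry u)) := by
  have e : projL Ω (mulL (oneCond Ω + h) (gradL Ω u))
      = gradL Ω u + projL Ω (mulL h (gradL Ω u)) - harmGrad Ω (bdry u) := by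
    rw [mulL_add, mulL_oneCond, harmGrad_bdry]
    change projL Ω (gradL Ω u + mulL h (gradL Ω u)) = _
    rw [map_add]
    abel
  rw [isWeakSolution_iff hΩ, e, sub_eq_zero]
  refine ⟨fun h1 => (solOp_eq_of_add_eq hh h1).symm, fun h1 => ?_⟩
  rw [h1]
  exact solOp_add hh _

theorem exists_isWeakSolution_one_add (hd : 1 ≤ d) (hΩ : Bornology.IsBounded (Ω : Set (Rd d)))
    {h : Lp ℝ ∞ (vol Ω)} (hh : ‖h‖ < 1) (f : Hhalf Ω) :
    ∃ u : H1 Ω, bdry u = f ∧ IsWeakSolution (oneCond Ω + h) u := by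
  obtain ⟨u, rfl⟩ := bdry_surjective f
  have e := solOp_add hh (harmGrad Ω (bdry u))
  obtain ⟨φ, hφ, hφ'⟩ := exists_gradL_eq_of_mem_gradSpace hd hΩ
    ((gradSpace Ω).add_mem (projL_apply_mem (gradL Ω u))
      (projL_apply_mem (mulL h (solOp h (harmGrad Ω (bdry u))))))
  have hb : bdry (u - φ) = bdry u := by rw [map_sub, bdry_eq_zero_iff.2 hφ, sub_zero]
  refine ⟨u - φ, hb, (isWeakSolution_one_add_iff hΩ hh).2 ?_⟩
  rw [hb, map_sub, hφ', ← sub_sub, ← harmGrad_bdry, sub_eq_iff_eq_add]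
  exact e.symm

theorem norm_solOp_le {h : Lp ℝ ∞ (vol Ω)} (hh : ‖h‖ ≤ 1 / 2) (G : L2Vec Ω) :
    ‖solOp h G‖ ≤ 2 * ‖G‖ := by
  have e := solOp_add (hh.trans_lt (by norm_num)) G
  have h1 : ‖projL Ω (mulL h (solOp h G))‖ ≤ 1 / 2 * ‖solOp h G‖ := by
    refine (norm_projL_apply_le _).trans ((norm_mulL_apply_le h _).trans ?_)
    exact mul_le_mul_of_nonneg_right hh (norm_nonneg _)
  have h2 : ‖solOp h G‖ ≤ ‖G‖ + ‖projL Ω (mulL h (solOp h G))‖ :=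
    (congrArg norm (eq_sub_of_add_eq e)).trans_le (norm_sub_le _ _)
  linarith

/-- The form `(f, g) ↦ ∫ ∇u_f · A∇u_g`, with `u_f`, `u_g` the harmonic functions with boundary
values `f`, `g`. -/
noncomputable def harmForm (A : L2Vec Ω →L[ℂ] L2Vec Ω) : Hhalf Ω →ₗ[ℂ] Hhalf Ω →ₗ[ℂ] ℂ :=
  (dotL Ω).compl₁₂ (harmGrad Ω) (A.toLinearMap ∘ₗ harmGrad Ω)

theorem harmForm_apply (A : L2Vec Ω →L[ℂ] L2Vec Ω) (f g : Hhalf Ω) :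
    harmForm A f g = dotL Ω (harmGrad Ω f) (A (harmGrad Ω g)) := rfl

theorem norm_harmForm_le (A : L2Vec Ω →L[ℂ] L2Vec Ω) (f g : Hhalf Ω) :
    ‖harmForm A f g‖ ≤ ‖A‖ * ‖f‖ * ‖g‖ := by
  rw [harmForm_apply]
  refine (norm_dotL_le _ _).trans ?_
  calc ‖harmGrad Ω f‖ * ‖A (harmGrad Ω g)‖
      ≤ ‖f‖ * (‖A‖ * ‖g‖) := by
        refine mul_le_mul (norm_harmGrad_le f) ?_ (norm_nonneg _) (norm_nonneg _)
        exact (A.le_opNorm _).trans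
          (mul_le_mul_of_nonneg_left (norm_harmGrad_le g) (norm_nonneg _))
    _ = ‖A‖ * ‖f‖ * ‖g‖ := by ring

theorem isDtN_one_add (hΩ : Bornology.IsBounded (Ω : Set (Rd d))) {h : Lp ℝ ∞ (vol Ω)}
    (hh : ‖h‖ < 1) :
    IsDtN (oneCond Ω + h) (opOfBilin (harmForm ((1 + mulL h) * solOp h))
      ‖(1 + mulL h) * solOp h‖ (norm_harmForm_le _)) := by
  intro u v hv
  have h1 := (isWeakSolution_one_add_iff hΩ hh).1 hv
  have h2 := (isWeakSolution_iff hΩ).1 hv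
  rw [bdryPair_opOfBilin, energy_eq_dotL, harmForm_apply, harmGrad_bdry, map_sub,
    LinearMap.sub_apply]
  have e : ((1 + mulL h) * solOp h) (harmGrad Ω (bdry v)) = mulL (oneCond Ω + h) (gradL Ω v) := by
    rw [mulL_add, mulL_oneCond, h1]
    rfl
  rw [e, dotL_eq_zero hΩ (projL_apply_mem _) h2, sub_zero]

/-- The Dirichlet-to-Neumann map of a conductivity near `1`: since a harmonic gradient is orthogonal
to the gradients of `H¹₀(Ω)` functions, `⟨f, Λ_{1+h} g⟩ = ∫ ∇u_f · ∇u_g + ∫ h ∇u_f · ∇v_g`, where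
`u_f`, `u_g` are harmonic and `v_g` solves `∇·((1 + h)∇v) = 0`. -/
theorem bdryPair_dtn_one_add (hd : 1 ≤ d) (hΩ : Bornology.IsBounded (Ω : Set (Rd d)))
    {h : Lp ℝ ∞ (vol Ω)} (hh : ‖h‖ < 1) (f g : Hhalf Ω) :
    bdryPair f (dtn (oneCond Ω + h) g)
      = harmForm 1 f g + dotL Ω (harmGrad Ω f) (mulL h (solOp h (harmGrad Ω g))) := by
  have hex : ∃ Λ : BdryOp Ω, IsDtN (oneCond Ω + h) Λ := ⟨_, isDtN_one_add hΩ hh⟩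
  have hdtn : IsDtN (oneCond Ω + h) (dtn (oneCond Ω + h)) := by
    rw [dtn, dif_pos hex]
    exact hex.choose_spec
  obtain ⟨u, rfl⟩ := bdry_surjective f
  obtain ⟨v, rfl, hv⟩ := exists_isWeakSolution_one_add hd hΩ hh g
  rw [hdtn u v hv, ← isDtN_one_add hΩ hh u v hv, bdryPair_opOfBilin, harmForm_apply]
  have e := eq_sub_of_add_eq (solOp_add hh (harmGrad Ω (bdry v)))
  have e2 : ((1 + mulL h) * solOp h) (harmGrad Ω (bdry v))
      = harmGrad Ω (bdry v) - projL Ω (mulL h (solOp h (harmGrad Ω (bdry v))))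
        + mulL h (solOp h (harmGrad Ω (bdry v))) :=
    congrArg (fun V => V + mulL h (solOp h (harmGrad Ω (bdry v)))) e
  rw [e2, map_add, map_sub, dotL_comm _ (projL Ω _),
    dotL_eq_zero hΩ (projL_apply_mem _) (projL_harmGrad _), sub_zero]
  rfl

/-- The differential of the Dirichlet-to-Neumann map at the conductivity `1`. -/
noncomputable def dtnDeriv (Ω : Opens (Rd d)) : Lp ℝ ∞ (vol Ω) →L[ℝ] BdryOp Ω :=
  LinearMap.mkContinuous
    { toFun := fun h => opOfBilin (harmForm (mulL h)) ‖mulL h‖ (norm_harmForm_le _)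
      map_add' := fun h k => bdryOp_ext fun f g => by
        change harmForm (mulL (h + k)) f g = harmForm (mulL h) f g + harmForm (mulL k) f g
        rw [mulL_add]
        exact map_add (dotL Ω (harmGrad Ω f)) _ _
      map_smul' := fun c h => bdryOp_ext fun f g => by
        change harmForm (mulL (c • h)) f g = c • harmForm (mulL h) f g
        rw [mulL_smul, Complex.real_smul]
        exact map_smul (dotL Ω (harmGrad Ω f)) _ _ } 1 (fun h => by
    rw [one_mul]
    refine norm_bdryOp_le (norm_nonneg h) fun f g => ?_
    refine (norm_harmForm_le (mulL h) f g).trans ?_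
    rw [mul_assoc, mul_assoc]
    exact mul_le_mul_of_nonneg_right (norm_mulL_le h) (by positivity))

theorem bdryPair_dtnDeriv (h : Lp ℝ ∞ (vol Ω)) (f g : Hhalf Ω) :
    bdryPair f (dtnDeriv Ω h g) = dotL Ω (harmGrad Ω f) (mulL h (harmGrad Ω g)) := rfl

theorem norm_dtn_sub_le (hd : 1 ≤ d) (hΩ : Bornology.IsBounded (Ω : Set (Rd d)))
    {h : Lp ℝ ∞ (vol Ω)} (hh : ‖h‖ ≤ 1 / 2) :
    ‖dtn (oneCond Ω + h) - dtn (oneCond Ω) - dtnDeriv Ω h‖ ≤ 2 * ‖h‖ ^ 2 := by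
  have hh1 : ‖h‖ < 1 := hh.trans_lt (by norm_num)
  refine norm_bdryOp_le (by positivity) fun f g => ?_
  change ‖bdryPair f (dtn (oneCond Ω + h) g) - bdryPair f (dtn (oneCond Ω) g)
    - bdryPair f (dtnDeriv Ω h g)‖ ≤ _
  have e0 : bdryPair f (dtn (oneCond Ω) g) = harmForm 1 f g := by
    have e := bdryPair_dtn_one_add hd hΩ (h := 0) (by simp) f g
    have m0 : mulL (0 : Lp ℝ ∞ (vol Ω)) = 0 := by
      have := mulL_add (0 : Lp ℝ ∞ (vol Ω)) 0
      rwa [add_zero, left_eq_add] at this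
    rwa [add_zero, m0, zero_apply, map_zero, add_zero] at e
  set G := harmGrad Ω g with hG
  have e1 : solOp h G - G = -projL Ω (mulL h (solOp h G)) := by
    rw [sub_eq_iff_eq_add, neg_add_eq_sub]
    exact eq_sub_of_add_eq (solOp_add hh1 G)
  rw [bdryPair_dtn_one_add hd hΩ hh1, e0, bdryPair_dtnDeriv, add_sub_cancel_left, ← map_sub,
    ← map_sub, ← hG, e1]
  refine (norm_dotL_le _ _).trans ?_
  have b1 : ‖mulL h (-projL Ω (mulL h (solOp h G)))‖ ≤ ‖h‖ * (‖h‖ * (2 * ‖g‖)) := by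
    refine (norm_mulL_apply_le h _).trans (mul_le_mul_of_nonneg_left ?_ (norm_nonneg _))
    rw [norm_neg]
    refine (norm_projL_apply_le _).trans ((norm_mulL_apply_le h _).trans
      (mul_le_mul_of_nonneg_left ?_ (norm_nonneg _)))
    exact (norm_solOp_le hh G).trans
      (mul_le_mul_of_nonneg_left (norm_harmGrad_le g) zero_le_two)
  refine (mul_le_mul (norm_harmGrad_le f) b1 (norm_nonneg _) (norm_nonneg _)).trans_eq ?_
  ring

theorem hasFDerivAt_dtn (hd : 1 ≤ d) (hΩ : Bornology.IsBounded (Ω : Set (Rd d))) :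
    HasFDerivAt (dtn (Ω := Ω)) (dtnDeriv Ω) (oneCond Ω) := by
  rw [hasFDerivAt_iff_isLittleO_nhds_zero]
  have h1 : (fun h : Lp ℝ ∞ (vol Ω) => dtn (oneCond Ω + h) - dtn (oneCond Ω) - dtnDeriv Ω h)
      =O[nhds 0] fun h => ‖h‖ ^ 2 := by
    refine Asymptotics.IsBigO.of_bound 2 ?_
    filter_upwards [Metric.closedBall_mem_nhds (0 : Lp ℝ ∞ (vol Ω)) (by norm_num : (0 : ℝ) < 1 / 2)]
      with h hh
    rw [mem_closedBall_zero_iff] at hh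
    rw [norm_pow, norm_norm]
    exact norm_dtn_sub_le hd hΩ hh
  refine h1.trans_isLittleO ?_
  exact Asymptotics.isLittleO_norm_pow_id one_lt_two

/-- `⟨f₁, dΦ₁(g) f₂⟩ = ∫ g ∇u₁ · ∇u₂` for complex `g ∈ L^∞(Ω)`, where `u₁`, `u₂` are the harmonic
functions with boundary values `f₁`, `f₂`. -/
theorem bdryPair_dtnDiff (hd : 1 ≤ d) (hΩ : Bornology.IsBounded (Ω : Set (Rd d)))
    (g : Lp ℂ ∞ (vol Ω)) (f₁ f₂ : Hhalf Ω) :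
    bdryPair f₁ (dtnDiff (oneCond Ω) g f₂)
      = ∫ x in (Ω : Set (Rd d)), g x * ∑ i, harmGrad Ω f₁ i x * harmGrad Ω f₂ i x := by
  have hint : ∀ k : Lp ℝ ∞ (vol Ω), Integrable
      (fun x => (k x : ℂ) * ∑ i, harmGrad Ω f₁ i x * harmGrad Ω f₂ i x) (vol Ω) := by
    intro k
    refine (integrable_finsetSum Finset.univ fun i _ => integrable_mul_L2 (harmGrad Ω f₁ i)
      (mulL k (harmGrad Ω f₂) i)).congr ?_
    filter_upwards [ae_all_iff.2 (mulL_ae k (harmGrad Ω f₂))] with x hx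
    rw [Finset.mul_sum]
    refine Finset.sum_congr rfl fun i _ => ?_
    rw [hx i]
    ring
  rw [dtnDiff, (hasFDerivAt_dtn hd hΩ).fderiv]
  change bdryPair f₁ (dtnDeriv Ω (Complex.reCLM.compLp g) f₂)
    + Complex.I * bdryPair f₁ (dtnDeriv Ω (Complex.imCLM.compLp g) f₂) = _
  rw [bdryPair_dtnDeriv, bdryPair_dtnDeriv, dotL_mulL_eq_integral, dotL_mulL_eq_integral,
    ← integral_const_mul, ← integral_add (hint _) ((hint _).const_mul _)]
  refine integral_congr_ae ?_
  filter_upwards [Complex.reCLM.coeFn_compLp g, Complex.imCLM.coeFn_compLp g] with x h1 h2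
  rw [h1, h2, Complex.reCLM_apply, Complex.imCLM_apply]
  conv_rhs => rw [← Complex.re_add_im (g x)]
  ring

end Differential

/-! ### Complex exponentials -/

section Exponentials

variable {d : ℕ} {Ω : Opens (Rd d)}

theorem partialDeriv_expFun (η : Fin d → ℂ) (i : Fin d) (x : Rd d) :
    partialDeriv i (expFun η) x = η i * expFun η x := by
  have h : HasFDerivAt (fun y : Rd d => ∑ j, η j * ((y j : ℝ) : ℂ))
      (∑ j, η j • Complex.ofRealCLM.comp (EuclideanSpace.proj (𝕜 := ℝ) j)) x :=
    HasFDerivAt.fun_sum fun j _ =>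
      ((Complex.ofRealCLM.comp (EuclideanSpace.proj (𝕜 := ℝ) j)).hasFDerivAt).const_mul (η j)
  have h2 := congrArg (fun L => L (EuclideanSpace.single i (1 : ℝ))) h.cexp.fderiv
  refine Eq.trans h2 ?_
  simp [expFun, mul_comm, PiLp.single_apply, apply_ite]

/-- `e_η` is harmonic if `η · η = 0`. -/
theorem isWeakSolution_ofSmooth_expFun (hΩ : Bornology.IsBounded (Ω : Set (Rd d))) {η : Fin d → ℂ}
    (hη : η ⬝ᵥ η = 0) :
    IsWeakSolution (oneCond Ω) (ofSmooth hΩ (expFun η) (expFun_contDiff η)) := by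
  intro φ hφ
  rw [energy_eq_dotL, mulL_oneCond]
  have hc : IsClosed {φ : H1 Ω |
      dotL Ω (gradL Ω φ) (gradL Ω (ofSmooth hΩ (expFun η) (expFun_contDiff η))) = 0} :=
    isClosed_eq (((conjL Ω).continuous.comp (gradL Ω).continuous).inner continuous_const)
      continuous_const
  refine hc.closure_subset_iff.2 ?_ hφ
  intro v hv
  obtain ⟨φ, rfl⟩ := exists_eq_ofSmooth_of_mem_testSubmodule hΩ hv
  change dotL Ω _ _ = 0
  have hpc : ∀ i, Continuous (partialDeriv i φ) := partialDeriv_continuous φ.contDiff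
  have hint : ∀ i, Integrable (fun x => η i * (partialDeriv i φ x * expFun η x)) (vol Ω) :=
    fun i => (((hpc i).mul (expFun_contDiff η).continuous).integrable_of_hasCompactSupport
      (φ.hasCompactSupport.fderiv_apply ℝ (EuclideanSpace.single i (1 : ℝ))).mul_right).const_mul _
  have h1 : dotL Ω (gradL Ω (ofSmooth hΩ φ φ.contDiff))
      (gradL Ω (ofSmooth hΩ (expFun η) (expFun_contDiff η)))
      = ∫ x in (Ω : Set (Rd d)), ∑ i, η i * (partialDeriv i φ x * expFun η x) := by
    rw [dotL_eq_integral]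
    refine integral_congr_ae ?_
    filter_upwards [ae_all_iff.2 (ofSmooth_grad_ae hΩ φ.contDiff),
      ae_all_iff.2 (ofSmooth_grad_ae hΩ (expFun_contDiff η))] with x h1 h2
    refine Finset.sum_congr rfl fun i _ => ?_
    rw [gradL_apply, gradL_apply, h1 i, h2 i, partialDeriv_expFun]
    ring
  have h2 : ∀ i, ∫ x in (Ω : Set (Rd d)), partialDeriv i φ x * expFun η x
      = -(η i * ∫ x in (Ω : Set (Rd d)), φ x * expFun η x) := by
    intro i
    rw [← neg_eq_iff_eq_neg, ← integral_test_mul_partialDeriv φ (expFun_contDiff η) i,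
      ← integral_const_mul]
    refine integral_congr_ae (Filter.Eventually.of_forall fun x => ?_)
    change φ x * partialDeriv i (expFun η) x = η i * (φ x * expFun η x)
    rw [partialDeriv_expFun]
    ring
  rw [h1, integral_finsetSum _ fun i _ => hint i]
  simp only [integral_const_mul, h2]
  have h3 : ∑ i, η i * -(η i * ∫ x in (Ω : Set (Rd d)), φ x * expFun η x)
      = -((η ⬝ᵥ η) * ∫ x in (Ω : Set (Rd d)), φ x * expFun η x) := by
    rw [dotProduct, Finset.sum_mul, ← Finset.sum_neg_distrib]
    exact Finset.sum_congr rfl fun i _ => by ring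
  rw [h3, hη, zero_mul, neg_zero]

theorem harmGrad_bdry_of_isWeakSolution (hΩ : Bornology.IsBounded (Ω : Set (Rd d))) {u : H1 Ω}
    (hu : IsWeakSolution (oneCond Ω) u) : harmGrad Ω (bdry u) = gradL Ω u := by
  have h := (isWeakSolution_iff hΩ).1 hu
  rw [mulL_oneCond] at h
  rw [harmGrad_bdry, show projL Ω (gradL Ω u) = 0 from h, sub_zero]

theorem eq_of_isWeakSolution_of_bdry_eq (hd : 1 ≤ d) (hΩ : Bornology.IsBounded (Ω : Set (Rd d)))
    {u v : H1 Ω} (hu : IsWeakSolution (oneCond Ω) u) (hv : IsWeakSolution (oneCond Ω) v)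
    (h : bdry u = bdry v) : u = v := by
  rw [← sub_eq_zero]
  refine eq_zero_of_mem_H10_of_gradL_eq_zero hd hΩ ?_ ?_
  · rw [← bdry_eq_zero_iff, map_sub, h, sub_self]
  · rw [map_sub, ← harmGrad_bdry_of_isWeakSolution hΩ hu, ← harmGrad_bdry_of_isWeakSolution hΩ hv,
      h, sub_self]

theorem smoothSolution_bdryExp (hd : 1 ≤ d) (hΩ : Bornology.IsBounded (Ω : Set (Rd d)))
    {η : Fin d → ℂ} (hη : η ⬝ᵥ η = 0) :
    Set.EqOn (smoothSolution (oneCond Ω) (bdryExp hΩ η)) (expFun η) Ω := by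
  have hw := isWeakSolution_ofSmooth_expFun hΩ hη
  have hex : ∃ U : Rd d → ℂ, ContDiffOn ℝ ∞ U Ω ∧ ∃ u : H1 Ω, IsWeakSolution (oneCond Ω) u ∧
      bdry u = bdryExp hΩ η ∧ ∀ᵐ x ∂(vol Ω), (sobVal u) x = U x :=
    ⟨expFun η, (expFun_contDiff η).contDiffOn, _, hw, rfl, ofSmooth_val_ae hΩ (expFun_contDiff η)⟩
  rw [smoothSolution, dif_pos hex]
  obtain ⟨hU, u, hu, hb, hae⟩ := hex.choose_spec
  have e := eq_of_isWeakSolution_of_bdry_eq hd hΩ hu hw hb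
  refine Measure.eqOn_open_of_ae_eq (μ := volume) ?_ Ω.isOpen hU.continuousOn
    (expFun_contDiff η).continuous.continuousOn
  filter_upwards [hae, ofSmooth_val_ae hΩ (expFun_contDiff η)] with x h1 h2
  rw [← h1, ← h2, e]

theorem partialDeriv_smoothSolution_bdryExp (hd : 1 ≤ d)
    (hΩ : Bornology.IsBounded (Ω : Set (Rd d))) {η : Fin d → ℂ} (hη : η ⬝ᵥ η = 0) (i : Fin d)
    {x : Rd d} (hx : x ∈ Ω) :
    partialDeriv i (smoothSolution (oneCond Ω) (bdryExp hΩ η)) x = η i * expFun η x := by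
  have h := ((smoothSolution_bdryExp hd hΩ hη).eventuallyEq_of_mem
    (Ω.isOpen.mem_nhds hx)).fderiv_eq (𝕜 := ℝ)
  rw [partialDeriv, h, ← partialDeriv, partialDeriv_expFun]

theorem expFun_mul_expFun {η₁ η₂ : Fin d → ℂ} {ξ : Rd d}
    (h : ∀ i, η₁ i + η₂ i = -Complex.I * (ξ i : ℂ)) (x : Rd d) :
    expFun η₁ x * expFun η₂ x = Complex.exp (-Complex.I * (inner ℝ x ξ : ℝ)) := by
  rw [expFun, expFun, ← Complex.exp_add, ← Finset.sum_add_distrib, PiLp.inner_apply,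
    Complex.ofReal_sum, Finset.mul_sum]
  congr 1
  refine Finset.sum_congr rfl fun i _ => ?_
  rw [← add_mul, h i]
  simp
  ring

theorem dotProduct_eq_of_isotropic {η₁ η₂ : Fin d → ℂ} {ξ : Rd d} (h₁ : η₁ ⬝ᵥ η₁ = 0)
    (h₂ : η₂ ⬝ᵥ η₂ = 0) (h : ∀ i, η₁ i + η₂ i = -Complex.I * (ξ i : ℂ)) :
    η₁ ⬝ᵥ η₂ = -((‖ξ‖ : ℂ) ^ 2 / 2) := by
  have hξ : ((‖ξ‖ : ℝ) : ℂ) ^ 2 = ∑ i, (ξ i : ℂ) ^ 2 := by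
    rw [← Complex.ofReal_pow, EuclideanSpace.real_norm_sq_eq]
    push_cast
    rfl
  have e : (η₁ + η₂) ⬝ᵥ (η₁ + η₂) = -∑ i, (ξ i : ℂ) ^ 2 := by
    rw [dotProduct, ← Finset.sum_neg_distrib]
    refine Finset.sum_congr rfl fun i _ => ?_
    rw [Pi.add_apply, h i]
    linear_combination (ξ i : ℂ) ^ 2 * Complex.I_sq
  rw [add_dotProduct, dotProduct_add, dotProduct_add, h₁, h₂, dotProduct_comm η₂ η₁] at e
  rw [hξ]
  linear_combination e / 2

/-- Every `-iξ` with `ξ ∈ ℝᵈ`, `d ≥ 2`, is a sum of two isotropic vectors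
`-iξ/2 ± (|ξ|/2) ω`, with `ω` a unit vector orthogonal to `ξ`. -/
theorem exists_isotropic_add_eq (hd : 2 ≤ d) (ξ : Rd d) :
    ∃ η₁ η₂ : Fin d → ℂ, η₁ ⬝ᵥ η₁ = 0 ∧ η₂ ⬝ᵥ η₂ = 0 ∧
      ∀ i, η₁ i + η₂ i = -Complex.I * (ξ i : ℂ) := by
  obtain ⟨v, hv, hv0⟩ : ∃ v : Rd d, inner ℝ ξ v = 0 ∧ v ≠ 0 := by
    have hne : (Submodule.span ℝ {ξ})ᗮ ≠ ⊥ := by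
      intro h
      rw [Submodule.orthogonal_eq_bot_iff] at h
      have h1 := finrank_span_le_card (R := ℝ) ({ξ} : Set (Rd d))
      rw [h, finrank_top, finrank_euclideanSpace_fin] at h1
      simp at h1
      omega
    obtain ⟨v, hv, hv0⟩ := Submodule.exists_mem_ne_zero_of_ne_bot hne
    exact ⟨v, (Submodule.mem_orthogonal_singleton_iff_inner_right).1 hv, hv0⟩
  have hvn : (‖v‖ : ℂ) ≠ 0 := by simpa using hv0
  have hsq : ∀ y : Rd d, ∑ i, (y i : ℂ) ^ 2 = ((‖y‖ : ℝ) : ℂ) ^ 2 := by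
    intro y
    rw [← Complex.ofReal_pow, EuclideanSpace.real_norm_sq_eq]
    push_cast
    rfl
  have hin : ∑ i, (ξ i : ℂ) * (v i : ℂ) = 0 := by
    rw [PiLp.inner_apply] at hv
    have := congrArg (fun r : ℝ => (r : ℂ)) hv
    simp only [Complex.ofReal_sum, Complex.ofReal_zero] at this
    rw [← this]
    refine Finset.sum_congr rfl fun i _ => ?_
    simp [mul_comm]
  -- With `v` orthogonal to `ξ`, the vectors are `-iξ/2 ± (|ξ| / (2|v|)) v`.
  have key : ∀ c : ℂ, c ^ 2 = (‖ξ‖ : ℂ) ^ 2 / (4 * (‖v‖ : ℂ) ^ 2) →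
      (fun i => -Complex.I / 2 * (ξ i : ℂ) + c * (v i : ℂ)) ⬝ᵥ
        (fun i => -Complex.I / 2 * (ξ i : ℂ) + c * (v i : ℂ)) = 0 := by
    intro c hc
    have e : ∀ i, (-Complex.I / 2 * (ξ i : ℂ) + c * (v i : ℂ)) *
        (-Complex.I / 2 * (ξ i : ℂ) + c * (v i : ℂ))
        = -1 / 4 * (ξ i : ℂ) ^ 2 + (-Complex.I * c) * ((ξ i : ℂ) * (v i : ℂ))
          + c ^ 2 * (v i : ℂ) ^ 2 := fun i => by
      linear_combination (ξ i : ℂ) ^ 2 / 4 * Complex.I_sq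
    rw [dotProduct, Finset.sum_congr rfl fun i _ => e i, Finset.sum_add_distrib,
      Finset.sum_add_distrib, ← Finset.mul_sum, ← Finset.mul_sum, ← Finset.mul_sum, hsq, hsq, hin,
      hc]
    field_simp
    ring
  refine ⟨_, _, key ((‖ξ‖ : ℂ) / (2 * ‖v‖)) (by field_simp; norm_num),
    key (-((‖ξ‖ : ℂ) / (2 * ‖v‖))) (by field_simp; norm_num), fun i => ?_⟩
  ring

/-- The formula for the Fourier transform: with the gradients `∇e_{η_j} = η_j e_{η_j}`, the identity
`dΦ₁(w) = B` at the boundary values of `e_{η₁}` and `e_{η₂}` reads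
`(η₁ · η₂) ℱw(ξ) = ⟨e_{η₁}, B e_{η₂}⟩`, and `η₁ · η₂ = -|ξ|²/2`. -/
theorem hasFourierValue_of_hasDtnDiff (hd : 1 ≤ d) (hΩ : Bornology.IsBounded (Ω : Set (Rd d)))
    {w : 𝓓'(Ω, ℂ)} {B : BdryOp Ω} (hw : HasDtnDiff (oneCond Ω) w B) {ξ : Rd d} (hξ : ξ ≠ 0)
    {η₁ η₂ : Fin d → ℂ} (h₁ : η₁ ⬝ᵥ η₁ = 0) (h₂ : η₂ ⬝ᵥ η₂ = 0)
    (h : ∀ i, η₁ i + η₂ i = -Complex.I * (ξ i : ℂ)) :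
    HasFourierValue w ξ (-(2 / (‖ξ‖ : ℂ) ^ 2) * bdryPair (bdryExp hΩ η₁) (B (bdryExp hΩ η₂))) := by
  obtain ⟨g, T, hs, hB⟩ := hw
  let E : Rd d → ℂ := fun x => Complex.exp (-Complex.I * (inner ℝ x ξ : ℝ))
  have hE : ContDiff ℝ ∞ E := Complex.contDiff_exp.comp (contDiff_const.mul
    (Complex.ofRealCLM.contDiff.comp (contDiff_id.inner ℝ contDiff_const)))
  refine ⟨⟨g, T, hs⟩, fun g' T' hs' => ?_⟩
  have hsum : ∀ x, ∑ i, (η₁ i * expFun η₁ x) * (η₂ i * expFun η₂ x) = (η₁ ⬝ᵥ η₂) * E x := by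
    intro x
    rw [dotProduct, Finset.sum_mul]
    refine Finset.sum_congr rfl fun i _ => ?_
    rw [show E x = _ from (expFun_mul_expFun h x).symm]
    ring
  have e1 : bdryPair (bdryExp hΩ η₁) (dtnDiff (oneCond Ω) g (bdryExp hΩ η₂))
      = (η₁ ⬝ᵥ η₂) * ∫ x in (Ω : Set (Rd d)), E x * g x := by
    rw [bdryPair_dtnDiff hd hΩ, ← integral_const_mul]
    refine integral_congr_ae ?_
    have a₁ := harmGrad_bdry_of_isWeakSolution hΩ (isWeakSolution_ofSmooth_expFun hΩ h₁)
    have a₂ := harmGrad_bdry_of_isWeakSolution hΩ (isWeakSolution_ofSmooth_expFun hΩ h₂)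
    filter_upwards [ae_all_iff.2 (ofSmooth_grad_ae hΩ (expFun_contDiff η₁)),
      ae_all_iff.2 (ofSmooth_grad_ae hΩ (expFun_contDiff η₂))] with x b₁ b₂
    rw [bdryExp, bdryExp, a₁, a₂, mul_comm (g x), ← mul_assoc, ← hsum x]
    congr 1
    refine Finset.sum_congr rfl fun i _ => ?_
    rw [gradL_apply, gradL_apply, b₁ i, b₂ i, partialDeriv_expFun, partialDeriv_expFun]
  have e2 : dtnDiffDistr (oneCond Ω) T (bdryExp hΩ η₁) (bdryExp hΩ η₂)
      = (η₁ ⬝ᵥ η₂) * pairing T E := by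
    rw [← pairing_smul hs.1 _ hE.contDiffOn, dtnDiffDistr]
    symm
    refine pairing_congr hs.1 (contDiff_const.smul hE).contDiffOn fun x hx => ?_
    rw [Pi.smul_apply, smul_eq_mul, ← hsum x]
    refine Finset.sum_congr rfl fun i _ => ?_
    rw [partialDeriv_smoothSolution_bdryExp hd hΩ h₁ i hx,
      partialDeriv_smoothSolution_bdryExp hd hΩ h₂ i hx]
  have e3 := hs'.integral_add_pairing_eq hΩ hs hE
  have hξ' : (‖ξ‖ : ℂ) ≠ 0 := by simpa using hξ
  change (∫ x in (Ω : Set (Rd d)), E x * g' x) + pairing T' E = _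
  rw [e3, ← hB, e1, e2, dotProduct_eq_of_isotropic h₁ h₂ h]
  field_simp
  ring

end Exponentials

end Calderon

theorem mainTheorem3 {d : ℕ} (hd : 2 ≤ d) (Ω : Opens (Rd d))
    (hΩ : Bornology.IsBounded (Ω : Set (Rd d)))
    (γ : Lp ℝ ∞ (vol Ω)) (hγ : IsConductivity γ)
    (w : 𝓓'(Ω, ℂ)) (hw : IsBornApprox γ w) :
    (∀ ξ : Rd d, ξ ≠ 0 → ∀ η₁ η₂ : Fin d → ℂ, η₁ ⬝ᵥ η₁ = 0 → η₂ ⬝ᵥ η₂ = 0 →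
      (∀ i, η₁ i + η₂ i = -Complex.I * (ξ i : ℂ)) →
      HasFourierValue w ξ
        (-(2 / (‖ξ‖ : ℂ) ^ 2) * bdryPair (bdryExp hΩ η₁) (dtn γ (bdryExp hΩ η₂)))) ∧
    (∀ (γ' : Lp ℝ ∞ (vol Ω)) (w' : 𝓓'(Ω, ℂ)), IsConductivity γ' → IsBornApprox γ' w' →
      dtn γ' = dtn γ → w' = w) := by
  have hd1 : 1 ≤ d := one_le_two.trans hd
  refine ⟨fun ξ hξ η₁ η₂ h₁ h₂ h => hasFourierValue_of_hasDtnDiff hd1 hΩ hw hξ h₁ h₂ h,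
    fun γ' w' _ hw' hΛ => ?_⟩
  refine eq_of_forall_hasFourierValue hd1 hΩ fun ξ hξ => ?_
  obtain ⟨η₁, η₂, h₁, h₂, h⟩ := exists_isotropic_add_eq hd ξ
  refine ⟨_, hasFourierValue_of_hasDtnDiff hd1 hΩ hw hξ h₁ h₂ h, ?_⟩
  rw [← hΛ]
  exact hasFourierValue_of_hasDtnDiff hd1 hΩ hw' hξ h₁ h₂ h
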